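/- Let $d\ge 1$. For $j=1,\dots,d$ let $p_j,q_j$ be positive functions on $(0,1)$ with $p_j/q_j$ strictly increasing, and let $$k(\mathbf x,\mathbf x')=\prod_{j=1}^d p_j(x_j\wedge x_j')\,q_j(x_j\vee x_j'),\qquad \mathbf x,\mathbf x'\in(0,1)^d,$$ be the associated tensor Markov kernel. Assume that for each $j$ the functions $p_j,q_j$ are continuously differentiable on $(0,1)$ with bounded derivatives (as is the case if they are continuously differentiable on $[0,1]$), and that both solve an equation $(u_jf')'+v_jf=0$ on $(0,1)$ with $u_j$ continuously differentiable and $v_j$ continuous on $(0,1)$. Let $\{\mathsf Y(\mathbf x):\mathbf x\in(0,1)^d\}$ be a zero mean Gaussian process with covariance function $k$, and let $\sigma:(0,1)^d\to[0,\infty)$. For $l\ge1$ let $\mathcal X_l=\{i2^{-l}:1\le i\le 2^l-1\}$. The classical sparse grid of level $\tau\ge1$ is $\mathcal X^{\mathsf{SG}}_\tau=\bigcup \mathcal X_{l_1}\times\cdots\times\mathcal X_{l_d}$, the union being over integers $l_1,\dots,l_d\ge1$ with $l_1+\cdots+l_d\le\tau+d-1$. A truncated sparse grid of size $n\ge 1$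 is a set $\mathcal X^{\mathsf{SG}}_\tau\cup\mathcal A$, where $|\mathcal X^{\mathsf{SG}}_\tau|\le n<|\mathcal X^{\mathsf{SG}}_{\tau+1}|$ and $\mathcal A$ is any set of $n-|\mathcal X^{\mathsf{SG}}_\tau|$ points of $\mathcal X^{\mathsf{SG}}_{\tau+1}\setminus\mathcal X^{\mathsf{SG}}_\tau$. For every $n\ge1$ let the design points $\mathbf x_1,\dots,\mathbf x_n$ (which may depend on $n$) form a truncated sparse grid of size $n$, let $m_1,\dots,m_n\ge1$ be integers (which may depend on $n$), and let $\bar Y_i=m_i^{-1}\sum_{r=1}^{m_i}(\mathsf Y(\mathbf x_i)+\epsilon_r(\mathbf x_i))$, where the $\epsilon_r(\mathbf x_i)$, $1\le i\le n$, $1\le r\le m_i$, are independent $N(0,\sigma^2(\mathbf x_i))$ random variables that are jointly independent of $\mathsf Y$. Let $$\widehat{\mathsf Y}_n(\mathbf x)=\mathbf k(\mathbf x)^{\mathsf T}(\mathbf K+\boldsymbol\Sigma)^{-1}\bar{\mathbf Y},$$ where $\mathbf k(\mathbf x)=(k(\mathbf x,\mathbf x_i))_{i}$, $\mathbf K=(k(\mathbf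 x_i,\mathbf x_j))_{i,j}$, $\boldsymbol\Sigma=\operatorname{diag}(\sigma^2(\mathbf x_i)/m_i)$ and $\bar{\mathbf Y}=(\bar Y_i)_i$, be the stochastic kriging predictor. If $(\log n)^d\max_{1\le i\le n}m_i^{-1/2}\sigma(\mathbf x_i)\to0$ as $n\to\infty$, then the mean squared errors below are finite, their suprema are finite, and, as $n\to\infty$, $$\sup_{\mathbf x\in(0,1)^d}\mathbb E\bigl[(\widehat{\mathsf Y}_n(\mathbf x)-\mathsf Y(\mathbf x))^2\bigr]=\mathcal O\Bigl(n^{-1}(\log n)^{2(d-1)}+(\log n)^d\max_{1\le i\le n}m_i^{-1/2}\sigma(\mathbf x_i)\Bigr).$$ -/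

import Mathlib

open MeasureTheory ProbabilityTheory Filter Topology Asymptotics Set

noncomputable section

namespace SparseKriging

/-- The open unit cube `(0,1)^d`. -/
def unitCube (d : ℕ) : Set (Fin d → ℝ) := {x | ∀ j, x j ∈ Ioo (0 : ℝ) 1}

/-! ### Tensor Markov kernels -/

/-- The kernel `k(x, y) = ∏ j, p_j (x_j ∧ y_j) * q_j (x_j ∨ y_j)`. -/
def tmKernel {d : ℕ} (p q : Fin d → ℝ → ℝ) (x y : Fin d → ℝ) : ℝ :=
  ∏ j, p j (min (x j) (y j)) * q j (max (x j) (y j))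

/-- `p` and `q` are the component functions of a tensor Markov kernel on `(0,1)^d`: they are
positive on `(0,1)`, with strictly increasing quotients. -/
structure IsTensorMarkov {d : ℕ} (p q : Fin d → ℝ → ℝ) : Prop where
  p_pos : ∀ j, ∀ t ∈ Ioo (0 : ℝ) 1, 0 < p j t
  q_pos : ∀ j, ∀ t ∈ Ioo (0 : ℝ) 1, 0 < q j t
  strictMono : ∀ j, StrictMonoOn (fun t => p j t / q j t) (Ioo (0 : ℝ) 1)

/-- `f` solves the Sturm-Liouville equation `(u f')' + v f = 0` on `(0,1)`. -/
def SolvesSturmLiouville (u v f : ℝ → ℝ) : Prop :=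
  ∀ t ∈ Ioo (0 : ℝ) 1, HasDerivAt (fun s => u s * deriv f s) (-(v t * f t)) t

/-- The Sturm-Liouville regularity of the component functions of a tensor Markov kernel on
`(0,1)^d`: `p_j` and `q_j` are continuously differentiable, with bounded derivatives, and
solve a common equation `(u_j f')' + v_j f = 0` on `(0,1)`, where `u_j` is continuously
differentiable and `v_j` is continuous on `(0,1)`. -/
structure SturmLiouvilleRegular {d : ℕ} (p q : Fin d → ℝ → ℝ) : Prop where
  p_contDiff : ∀ j, ContDiffOn ℝ 1 (p j) (Ioo (0 : ℝ) 1)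
  q_contDiff : ∀ j, ContDiffOn ℝ 1 (q j) (Ioo (0 : ℝ) 1)
  p_deriv_bdd : ∀ j, ∃ B : ℝ, ∀ t ∈ Ioo (0 : ℝ) 1, |deriv (p j) t| ≤ B
  q_deriv_bdd : ∀ j, ∃ B : ℝ, ∀ t ∈ Ioo (0 : ℝ) 1, |deriv (q j) t| ≤ B
  ode : ∀ j, ∃ u v : ℝ → ℝ, ContDiffOn ℝ 1 u (Ioo (0 : ℝ) 1) ∧
    ContinuousOn v (Ioo (0 : ℝ) 1) ∧
    SolvesSturmLiouville u v (p j) ∧ SolvesSturmLiouville u v (q j)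

/-- `Y` is, on the set `S`, a zero mean Gaussian process with covariance function `k`. -/
structure IsCenteredGP {d : ℕ} {Ω : Type*} [MeasurableSpace Ω] (S : Set (Fin d → ℝ))
    (k : (Fin d → ℝ) → (Fin d → ℝ) → ℝ) (Y : (Fin d → ℝ) → Ω → ℝ) (P : Measure Ω) : Prop where
  gaussian : IsGaussianProcess (fun z : S => Y z) P
  mean_zero : ∀ z ∈ S, ∫ ω, Y z ω ∂P = 0
  cov_eq : ∀ z ∈ S, ∀ z' ∈ S, covariance (Y z) (Y z') P = k z z'

/-! ### Sparse grids -/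

/-- The dyadic one-dimensional design `{i * 2^{-l} : 1 ≤ i ≤ 2^l - 1}`. -/
def dyadicGrid (l : ℕ) : Finset ℝ :=
  (Finset.Icc 1 (2 ^ l - 1)).image (fun i : ℕ => (i : ℝ) / 2 ^ l)

/-- The level vectors `l` with all `l_j ≥ 1` and `l_1 + ... + l_d ≤ τ + d - 1`. -/
def sparseLevels (d τ : ℕ) : Finset (Fin d → ℕ) :=
  (Fintype.piFinset fun _ => Finset.Icc 1 (τ + d - 1)).filter
    (fun l => ∑ j, l j ≤ τ + d - 1)

/-- The classical sparse grid of level `τ` in dimension `d`. -/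
def sparseGrid (d τ : ℕ) : Finset (Fin d → ℝ) :=
  (sparseLevels d τ).biUnion (fun l => Fintype.piFinset fun j => dyadicGrid (l j))

/-- `X` is a truncated sparse grid of size `n`: the union of the classical sparse grid of the
level `τ` determined by `n`, and of an arbitrary set of the right number of points of the
classical sparse grid of level `τ + 1` that are not in the one of level `τ`. -/
def IsTruncatedSparseGrid (d n : ℕ) (X : Finset (Fin d → ℝ)) : Prop :=
  ∃ τ : ℕ, 1 ≤ τ ∧ (sparseGrid d τ).card ≤ n ∧ n < (sparseGrid d (τ + 1)).card ∧
    ∃ A : Finset (Fin d → ℝ), A ⊆ sparseGrid d (τ + 1) \ sparseGrid d τ ∧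
      A.card = n - (sparseGrid d τ).card ∧ X = sparseGrid d τ ∪ A

/-! ### Stochastic kriging -/

/-- The kernel matrix, with entries `k(x_i, x_j)`. -/
def kernelMatrix {d n : ℕ} (k : (Fin d → ℝ) → (Fin d → ℝ) → ℝ) (x : Fin n → Fin d → ℝ) :
    Matrix (Fin n) (Fin n) ℝ :=
  Matrix.of fun i j => k (x i) (x j)

/-- The covariance matrix of the averaged noise, `diag (σ²(x_i) / m_i)`. -/
def noiseMatrix {d n : ℕ} (σ : (Fin d → ℝ) → ℝ) (x : Fin n → Fin d → ℝ) (m : Fin n → ℕ) :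
    Matrix (Fin n) (Fin n) ℝ :=
  Matrix.diagonal fun i => σ (x i) ^ 2 / (m i : ℝ)

/-- The averaged simulation outputs `m_i⁻¹ ∑_{r < m_i} (Y(x_i) + ε_r(x_i))`. -/
def sampleMean {d n : ℕ} {Ω : Type*} (x : Fin n → Fin d → ℝ) (m : Fin n → ℕ)
    (Y : (Fin d → ℝ) → Ω → ℝ) (ε : Fin n → ℕ → Ω → ℝ) (ω : Ω) (i : Fin n) : ℝ :=
  (m i : ℝ)⁻¹ * ∑ r ∈ Finset.range (m i), (Y (x i) ω + ε i r ω)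

/-- The stochastic kriging predictor `k(z)ᵀ (K + Σ)⁻¹ Ybar` at `z`. -/
def skPredictor {d n : ℕ} {Ω : Type*} (k : (Fin d → ℝ) → (Fin d → ℝ) → ℝ)
    (σ : (Fin d → ℝ) → ℝ) (x : Fin n → Fin d → ℝ) (m : Fin n → ℕ)
    (Y : (Fin d → ℝ) → Ω → ℝ) (ε : Fin n → ℕ → Ω → ℝ) (z : Fin d → ℝ) (ω : Ω) : ℝ :=
  (fun i => k z (x i)) ⬝ᵥ
    ((kernelMatrix k x + noiseMatrix σ x m)⁻¹.mulVec (sampleMean x m Y ε ω))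

/-- `ε i r`, for `i < n` and `r < m_i`, is the noise of the `r`-th replication at `x_i`: these
variables are independent, centred Gaussian with variance `σ²(x_i)`, and jointly independent of
the process `Y` on the unit cube. -/
structure IsSimulationNoise {d n : ℕ} {Ω : Type*} [MeasurableSpace Ω] (σ : (Fin d → ℝ) → ℝ)
    (x : Fin n → Fin d → ℝ) (m : Fin n → ℕ) (Y : (Fin d → ℝ) → Ω → ℝ)
    (ε : Fin n → ℕ → Ω → ℝ) (P : Measure Ω) : Prop where
  law : ∀ i, ∀ r < m i, HasLaw (ε i r) (gaussianReal 0 (Real.toNNReal (σ (x i) ^ 2))) P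
  indep : iIndepFun (fun a : (i : Fin n) × Fin (m i) => ε a.1 a.2) P
  indep_process : IndepFun (fun ω (a : (i : Fin n) × Fin (m i)) => ε a.1 a.2 ω)
    (fun ω (z : unitCube d) => Y z ω) P

/-- The noise level `max_i m_i^{-1/2} σ(x_i)`. -/
def maxNoise {d n : ℕ} (σ : (Fin d → ℝ) → ℝ) (x : Fin n → Fin d → ℝ) (m : Fin n → ℕ) : ℝ :=
  ⨆ i : Fin n, (m i : ℝ) ^ (-(1 / 2) : ℝ) * σ (x i)

end SparseKriging

end

/-!
Among all linear predictors built from the averaged outputs, the kriging predictor has the least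
mean squared error, so it suffices to exhibit one good vector of weights. The bias of any weights
is a quadratic form in the kernel, and their noise contributes at most the square of their total
mass times the noise level.

Take the Smolyak combination: replace each coordinate of the point by nearby dyadic points, one
per level, and keep the tensor products of hierarchical differences whose levels are admissible
for the sparse grid. Since the one-dimensional kernels `p_j (s ∧ t) q_j (s ∨ t)` are bounded and
Lipschitz, the differences of levels `l` and `l'` have covariance at most a constant times
`∏ j, min (2 ^ (-l_j)) (2 ^ (-l'_j))`. Summing over `l'` leaves a constant times `2 ^ (-|l|)`, and
the discarded levels, of total size at least `τ + d`, contribute `τ ^ (d - 1) * 2 ^ (-τ)`. The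
weights have total mass of order `τ ^ d`, and `τ` is of the order of `log n`.
-/

namespace SparseKriging

/-! ### Best linear prediction -/

section QuadraticRisk

variable {ι : Type*} [Fintype ι] {M : Matrix ι ι ℝ} {κ : ι → ℝ} {c : ℝ} {w : ι → ℝ}

/-- The quadratic risk `wᵀ M w - 2 wᵀ κ + c` of the weights `w`. It is the mean squared error of
`∑ i, w i * Z i` as a predictor of `V` when `M`, `κ` and `c` hold the second moments of `Z` and
`V`. -/
noncomputable def quadraticRisk (M : Matrix ι ι ℝ) (κ : ι → ℝ) (c : ℝ) (w : ι → ℝ) : ℝ :=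
  w ⬝ᵥ M.mulVec w - 2 * (w ⬝ᵥ κ) + c

lemma quadraticRisk_zero : quadraticRisk M κ c 0 = c := by simp [quadraticRisk]

lemma quadraticRisk_add_diagonal [DecidableEq ι] (a : ι → ℝ) :
    quadraticRisk (M + Matrix.diagonal a) κ c w = quadraticRisk M κ c w + ∑ i, w i ^ 2 * a i := by
  have hdiag : w ⬝ᵥ (Matrix.diagonal a).mulVec w = ∑ i, w i ^ 2 * a i := by
    simp only [dotProduct, Matrix.mulVec_diagonal]
    exact Finset.sum_congr rfl fun i _ ↦ by ring
  rw [quadraticRisk, quadraticRisk, Matrix.add_mulVec, dotProduct_add, hdiag]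
  ring

lemma quadraticRisk_vecMul_inv_le [DecidableEq ι] (hM : M.PosDef) :
    quadraticRisk M κ c (Matrix.vecMul κ M⁻¹) ≤ quadraticRisk M κ c w := by
  set v := Matrix.vecMul κ M⁻¹
  have hvM : Matrix.vecMul v M = κ := by
    rw [Matrix.vecMul_vecMul, Matrix.nonsing_inv_mul _ hM.det_pos.ne'.isUnit, Matrix.vecMul_one]
  have hsymm : M.transpose = M := by simpa using hM.isHermitian.eq
  have hMv : M.mulVec v = κ := by rw [← hsymm, Matrix.mulVec_transpose, hvM]
  have hvMw : v ⬝ᵥ M.mulVec w = w ⬝ᵥ κ := by rw [Matrix.dotProduct_mulVec, hvM, dotProduct_comm]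
  have hsq : quadraticRisk M κ c w - quadraticRisk M κ c v = (w - v) ⬝ᵥ M.mulVec (w - v) := by
    rw [quadraticRisk, quadraticRisk, Matrix.mulVec_sub, dotProduct_sub, sub_dotProduct,
      sub_dotProduct, hvMw, hMv]
    ring
  have hpos : 0 ≤ (w - v) ⬝ᵥ M.mulVec (w - v) := by
    simpa using hM.posSemidef.dotProduct_mulVec_nonneg (w - v)
  linarith

end QuadraticRisk

section SecondMoments

variable {Ω : Type*} [MeasurableSpace Ω] {P : Measure Ω} {ι κ : Type*}

lemma integrable_mul_of_memLp_two {X Z : Ω → ℝ} (hX : MemLp X 2 P) (hZ : MemLp Z 2 P) :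
    Integrable (fun ω ↦ X ω * Z ω) P :=
  hX.integrable_mul hZ

lemma integral_sum_mul_sum {s : Finset ι} {t : Finset κ} {X : ι → Ω → ℝ} {Z : κ → Ω → ℝ}
    (hX : ∀ i ∈ s, MemLp (X i) 2 P) (hZ : ∀ j ∈ t, MemLp (Z j) 2 P) :
    ∫ ω, (∑ i ∈ s, X i ω) * ∑ j ∈ t, Z j ω ∂P = ∑ i ∈ s, ∑ j ∈ t, ∫ ω, X i ω * Z j ω ∂P := by
  have hint : ∀ i ∈ s, ∀ j ∈ t, Integrable (fun ω ↦ X i ω * Z j ω) P :=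
    fun i hi j hj ↦ integrable_mul_of_memLp_two (hX i hi) (hZ j hj)
  simp only [Finset.sum_mul_sum]
  rw [integral_finsetSum _ fun i hi ↦ integrable_finsetSum _ (hint i hi)]
  exact Finset.sum_congr rfl fun i hi ↦ integral_finsetSum _ (hint i hi)

lemma integral_sq_dotProduct_sub [Fintype ι] {Z : ι → Ω → ℝ} {V : Ω → ℝ}
    (hZ : ∀ i, MemLp (Z i) 2 P) (hV : MemLp V 2 P) (w : ι → ℝ) :
    ∫ ω, (w ⬝ᵥ (Z · ω) - V ω) ^ 2 ∂P
      = quadraticRisk (Matrix.of fun i j ↦ ∫ ω, Z i ω * Z j ω ∂P) (fun i ↦ ∫ ω, Z i ω * V ω ∂P)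
          (∫ ω, V ω * V ω ∂P) w := by
  have hwZ : ∀ i ∈ Finset.univ, MemLp (fun ω ↦ w i * Z i ω) 2 P := fun i _ ↦ (hZ i).const_mul _
  have hS : MemLp (fun ω ↦ w ⬝ᵥ (Z · ω)) 2 P := memLp_finsetSum _ hwZ
  have hSS : ∫ ω, w ⬝ᵥ (Z · ω) * w ⬝ᵥ (Z · ω) ∂P
      = w ⬝ᵥ (Matrix.of fun i j ↦ ∫ ω, Z i ω * Z j ω ∂P).mulVec w := by
    simp only [dotProduct]
    rw [integral_sum_mul_sum hwZ hwZ]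
    simp only [Matrix.mulVec, dotProduct, Matrix.of_apply, Finset.mul_sum]
    refine Finset.sum_congr rfl fun i _ ↦ Finset.sum_congr rfl fun j _ ↦ ?_
    rw [← integral_mul_const, ← integral_const_mul]
    exact integral_congr_ae (.of_forall fun ω ↦ by ring)
  have hSV : ∫ ω, w ⬝ᵥ (Z · ω) * V ω ∂P = w ⬝ᵥ fun i ↦ ∫ ω, Z i ω * V ω ∂P := by
    simp only [dotProduct, Finset.sum_mul, mul_assoc]
    rw [integral_finsetSum _ fun i _ ↦ (integrable_mul_of_memLp_two (hZ i) hV).const_mul _]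
    simp only [integral_const_mul]
  have hsq : ∀ ω, (w ⬝ᵥ (Z · ω) - V ω) ^ 2
      = w ⬝ᵥ (Z · ω) * w ⬝ᵥ (Z · ω) + V ω * V ω - 2 * (w ⬝ᵥ (Z · ω) * V ω) := fun ω ↦ by ring
  have hintSS := integrable_mul_of_memLp_two hS hS
  have hintVV := integrable_mul_of_memLp_two hV hV
  have hintSV := (integrable_mul_of_memLp_two hS hV).const_mul 2
  simp only [hsq]
  rw [integral_sub (hintSS.fun_add hintVV) hintSV, integral_add hintSS hintVV, integral_const_mul,
    hSS, hSV, quadraticRisk]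
  ring

end SecondMoments

/-- `Y` is, on the set `S`, a second-order process with second moments `k`. -/
structure IsSecondOrderProcess {E Ω : Type*} [MeasurableSpace Ω] (S : Set E) (k : E → E → ℝ)
    (Y : E → Ω → ℝ) (P : Measure Ω) : Prop where
  memLp : ∀ z ∈ S, MemLp (Y z) 2 P
  integral_mul : ∀ z ∈ S, ∀ z' ∈ S, ∫ ω, Y z ω * Y z' ω ∂P = k z z'

/-- The simulation noise `ε i r`, for `i < n` and `r < m i`, has second moments `σ²(x_i)`, and its
members are orthogonal in `L²` to each other and to the process `Y` on the set `S`. -/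
structure IsUncorrelatedNoise {d n : ℕ} {Ω : Type*} [MeasurableSpace Ω] (S : Set (Fin d → ℝ))
    (σ : (Fin d → ℝ) → ℝ) (x : Fin n → Fin d → ℝ) (m : Fin n → ℕ) (Y : (Fin d → ℝ) → Ω → ℝ)
    (ε : Fin n → ℕ → Ω → ℝ) (P : Measure Ω) : Prop where
  memLp : ∀ i, ∀ r < m i, MemLp (ε i r) 2 P
  integral_mul : ∀ i, ∀ r < m i, ∀ j, ∀ s < m j,
    ∫ ω, ε i r ω * ε j s ω ∂P = if i = j ∧ r = s then σ (x i) ^ 2 else 0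
  integral_process_mul : ∀ z ∈ S, ∀ i, ∀ r < m i, ∫ ω, Y z ω * ε i r ω ∂P = 0

section Gaussian

variable {Ω : Type*} [MeasurableSpace Ω] {P : Measure Ω} {d n : ℕ}
  {k : (Fin d → ℝ) → (Fin d → ℝ) → ℝ} {Y : (Fin d → ℝ) → Ω → ℝ} {σ : (Fin d → ℝ) → ℝ}
  {x : Fin n → Fin d → ℝ} {m : Fin n → ℕ} {ε : Fin n → ℕ → Ω → ℝ}

lemma IsCenteredGP.isSecondOrderProcess [IsProbabilityMeasure P] {S : Set (Fin d → ℝ)}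
    (hY : IsCenteredGP S k Y P) : IsSecondOrderProcess S k Y P := by
  have hmem : ∀ z ∈ S, MemLp (Y z) 2 P :=
    fun z hz ↦ (hY.gaussian.hasGaussianLaw_eval ⟨z, hz⟩).memLp_two
  refine ⟨hmem, fun z hz z' hz' ↦ ?_⟩
  rw [← hY.cov_eq z hz z' hz', covariance_eq_sub (hmem z hz) (hmem z' hz'), hY.mean_zero z hz,
    zero_mul, sub_zero]
  rfl

namespace IsSimulationNoise

lemma memLp (hε : IsSimulationNoise σ x m Y ε P) {i : Fin n} {r : ℕ} (hr : r < m i) :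
    MemLp (ε i r) 2 P := by
  have hlaw := hε.law i r hr
  have hid : MemLp id 2 (P.map (ε i r)) := hlaw.map_eq ▸ memLp_id_gaussianReal 2
  exact (memLp_map_measure_iff hid.1 hlaw.aemeasurable).1 hid

lemma integral_eq_zero (hε : IsSimulationNoise σ x m Y ε P) {i : Fin n} {r : ℕ} (hr : r < m i) :
    ∫ ω, ε i r ω ∂P = 0 := by
  rw [(hε.law i r hr).integral_eq, integral_id_gaussianReal]

lemma integral_sq (hε : IsSimulationNoise σ x m Y ε P) {i : Fin n} {r : ℕ} (hr : r < m i) :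
    ∫ ω, ε i r ω ^ 2 ∂P = σ (x i) ^ 2 := by
  have hlaw := hε.law i r hr
  rw [← variance_of_integral_eq_zero hlaw.aemeasurable (hε.integral_eq_zero hr),
    hlaw.variance_eq, variance_id_gaussianReal, Real.coe_toNNReal _ (sq_nonneg _)]

lemma isUncorrelatedNoise (hε : IsSimulationNoise σ x m Y ε P)
    (hY : ∀ z ∈ unitCube d, AEStronglyMeasurable (Y z) P) :
    IsUncorrelatedNoise (unitCube d) σ x m Y ε P where
  memLp _ _ hr := hε.memLp hr
  integral_mul i r hr j s hs := by
    split_ifs with h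
    · obtain ⟨rfl, rfl⟩ := h
      simpa only [sq] using hε.integral_sq hr
    · have hne : (⟨i, r, hr⟩ : (i : Fin n) × Fin (m i)) ≠ ⟨j, s, hs⟩ := by
        contrapose! h
        obtain ⟨rfl, h⟩ := Sigma.mk.inj_iff.1 h
        exact ⟨rfl, congrArg Fin.val (eq_of_heq h)⟩
      rw [(hε.indep.indepFun hne).integral_fun_mul_eq_mul_integral (hε.memLp hr).1 (hε.memLp hs).1,
        hε.integral_eq_zero hr, zero_mul]
  integral_process_mul z hz i r hr := by
    have hind : IndepFun (Y z) (ε i r) P := hε.indep_process.symm.comp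
      (measurable_pi_apply (⟨z, hz⟩ : unitCube d))
      (measurable_pi_apply (⟨i, r, hr⟩ : (i : Fin n) × Fin (m i)))
    rw [hind.integral_fun_mul_eq_mul_integral (hY z hz) (hε.memLp hr).1, hε.integral_eq_zero hr,
      mul_zero]

end IsSimulationNoise

end Gaussian

section Kriging

variable {Ω : Type*} [MeasurableSpace Ω] {P : Measure Ω} {d n : ℕ} {S : Set (Fin d → ℝ)}
  {k : (Fin d → ℝ) → (Fin d → ℝ) → ℝ} {Y : (Fin d → ℝ) → Ω → ℝ} {σ : (Fin d → ℝ) → ℝ}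
  {x : Fin n → Fin d → ℝ} {m : Fin n → ℕ} {ε : Fin n → ℕ → Ω → ℝ} {z : Fin d → ℝ}

omit [MeasurableSpace Ω] in
lemma sampleMean_eq_sum (ω : Ω) (i : Fin n) :
    sampleMean x m Y ε ω i
      = ∑ r ∈ Finset.range (m i), (m i : ℝ)⁻¹ * (Y (x i) ω + ε i r ω) := by
  rw [sampleMean, Finset.mul_sum]

lemma memLp_replication (hY : IsSecondOrderProcess S k Y P)
    (hε : IsUncorrelatedNoise S σ x m Y ε P) (hx : ∀ i, x i ∈ S) (i : Fin n) :
    ∀ r ∈ Finset.range (m i), MemLp (fun ω ↦ (m i : ℝ)⁻¹ * (Y (x i) ω + ε i r ω)) 2 P :=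
  fun r hr ↦ ((hY.memLp _ (hx i)).add (hε.memLp i r (Finset.mem_range.1 hr))).const_mul _

lemma memLp_sampleMean (hY : IsSecondOrderProcess S k Y P)
    (hε : IsUncorrelatedNoise S σ x m Y ε P) (hx : ∀ i, x i ∈ S) (i : Fin n) :
    MemLp (sampleMean x m Y ε · i) 2 P := by
  simp only [sampleMean_eq_sum]
  exact memLp_finsetSum _ (memLp_replication hY hε hx i)

lemma integral_replication_mul (hY : IsSecondOrderProcess S k Y P)
    (hε : IsUncorrelatedNoise S σ x m Y ε P) (hx : ∀ i, x i ∈ S) {i j : Fin n} {r s : ℕ}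
    (hr : r < m i) (hs : s < m j) :
    ∫ ω, (Y (x i) ω + ε i r ω) * (Y (x j) ω + ε j s ω) ∂P
      = k (x i) (x j) + if i = j ∧ r = s then σ (x i) ^ 2 else 0 := by
  have hYi := hY.memLp _ (hx i)
  have hYj := hY.memLp _ (hx j)
  have hεi := hε.memLp i r hr
  have hεj := hε.memLp j s hs
  have hYY := integrable_mul_of_memLp_two hYi hYj
  have hYε := integrable_mul_of_memLp_two hYi hεj
  have hεY := integrable_mul_of_memLp_two hYj hεi
  have hεε := integrable_mul_of_memLp_two hεi hεj
  have hexp : ∀ ω, (Y (x i) ω + ε i r ω) * (Y (x j) ω + ε j s ω)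
      = (Y (x i) ω * Y (x j) ω + ε i r ω * ε j s ω)
        + (Y (x i) ω * ε j s ω + Y (x j) ω * ε i r ω) := fun ω ↦ by ring
  simp only [hexp]
  rw [integral_add (hYY.fun_add hεε) (hYε.fun_add hεY), integral_add hYY hεε, integral_add hYε hεY,
    hY.integral_mul _ (hx i) _ (hx j), hε.integral_mul i r hr j s hs,
    hε.integral_process_mul _ (hx i) j s hs, hε.integral_process_mul _ (hx j) i r hr, add_zero,
    add_zero]

lemma integral_sampleMean_mul_sampleMean (hY : IsSecondOrderProcess S k Y P)
    (hε : IsUncorrelatedNoise S σ x m Y ε P) (hx : ∀ i, x i ∈ S) (hm : ∀ i, 1 ≤ m i)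
    (i j : Fin n) :
    ∫ ω, sampleMean x m Y ε ω i * sampleMean x m Y ε ω j ∂P
      = (kernelMatrix k x + noiseMatrix σ x m) i j := by
  have hm' : ∀ i, (m i : ℝ) ≠ 0 := fun i ↦ Nat.cast_ne_zero.2 (Nat.one_le_iff_ne_zero.1 (hm i))
  have hrep : ∀ r ∈ Finset.range (m i), ∀ s ∈ Finset.range (m j),
      ∫ ω, (m i : ℝ)⁻¹ * (Y (x i) ω + ε i r ω) * ((m j : ℝ)⁻¹ * (Y (x j) ω + ε j s ω)) ∂P
        = (m i : ℝ)⁻¹ * (m j : ℝ)⁻¹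
          * (k (x i) (x j) + if i = j ∧ r = s then σ (x i) ^ 2 else 0) := fun r hr s hs ↦ by
    simp only [mul_mul_mul_comm (m i : ℝ)⁻¹ _ (m j : ℝ)⁻¹ _]
    rw [integral_const_mul, integral_replication_mul hY hε hx (Finset.mem_range.1 hr)
      (Finset.mem_range.1 hs)]
  simp only [sampleMean_eq_sum]
  rw [integral_sum_mul_sum (memLp_replication hY hε hx i) (memLp_replication hY hε hx j),
    Finset.sum_congr rfl fun r hr ↦ Finset.sum_congr rfl (hrep r hr)]
  simp only [← Finset.mul_sum, Finset.sum_add_distrib, Finset.sum_const, Finset.card_range,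
    nsmul_eq_mul]
  rw [kernelMatrix, noiseMatrix, Matrix.add_apply, Matrix.of_apply, Matrix.diagonal_apply]
  have hi := hm' i
  have hj := hm' j
  by_cases hij : i = j
  · subst hij
    have hdiag : ∑ r ∈ Finset.range (m i), ∑ s ∈ Finset.range (m i),
        (if r = s then σ (x i) ^ 2 else 0) = m i * σ (x i) ^ 2 := by
      rw [Finset.sum_congr rfl fun r hr ↦ by rw [Finset.sum_ite_eq, if_pos hr], Finset.sum_const,
        Finset.card_range, nsmul_eq_mul]
    simp only [true_and, if_true, hdiag]
    field_simp
  · simp only [hij, false_and, if_false, Finset.sum_const_zero, add_zero]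
    field_simp

lemma integral_sampleMean_mul (hY : IsSecondOrderProcess S k Y P)
    (hε : IsUncorrelatedNoise S σ x m Y ε P) (hx : ∀ i, x i ∈ S) (hm : ∀ i, 1 ≤ m i) (hz : z ∈ S)
    (i : Fin n) : ∫ ω, sampleMean x m Y ε ω i * Y z ω ∂P = k z (x i) := by
  have hYz := hY.memLp z hz
  have hrep : ∀ r ∈ Finset.range (m i),
      ∫ ω, (m i : ℝ)⁻¹ * (Y (x i) ω + ε i r ω) * Y z ω ∂P = (m i : ℝ)⁻¹ * k z (x i) := by
    intro r hr
    have hr' := Finset.mem_range.1 hr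
    simp only [mul_assoc, mul_comm (_ + _) (Y z _), mul_add (Y z _)]
    rw [integral_const_mul, integral_add (integrable_mul_of_memLp_two hYz (hY.memLp _ (hx i)))
      (integrable_mul_of_memLp_two hYz (hε.memLp i r hr')), hY.integral_mul z hz _ (hx i),
      hε.integral_process_mul z hz i r hr', add_zero]
  simp only [sampleMean_eq_sum, Finset.sum_mul]
  rw [integral_finsetSum _ fun r hr ↦ integrable_mul_of_memLp_two
      (memLp_replication hY hε hx i r hr) hYz,
    Finset.sum_congr rfl hrep, Finset.sum_const, Finset.card_range, nsmul_eq_mul,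
    mul_inv_cancel_left₀ (Nat.cast_ne_zero.2 (Nat.one_le_iff_ne_zero.1 (hm i)))]

lemma integral_sq_dotProduct_sampleMean_sub (hY : IsSecondOrderProcess S k Y P)
    (hε : IsUncorrelatedNoise S σ x m Y ε P) (hx : ∀ i, x i ∈ S) (hm : ∀ i, 1 ≤ m i) (hz : z ∈ S)
    (w : Fin n → ℝ) :
    ∫ ω, (w ⬝ᵥ sampleMean x m Y ε ω - Y z ω) ^ 2 ∂P
      = quadraticRisk (kernelMatrix k x + noiseMatrix σ x m) (fun i ↦ k z (x i)) (k z z) w := by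
  rw [integral_sq_dotProduct_sub (memLp_sampleMean hY hε hx) (hY.memLp z hz) w,
    hY.integral_mul z hz z hz]
  simp only [integral_sampleMean_mul_sampleMean hY hε hx hm,
    integral_sampleMean_mul hY hε hx hm hz]
  rfl

omit [MeasurableSpace Ω] in
lemma skPredictor_eq_dotProduct (ω : Ω) :
    skPredictor k σ x m Y ε z ω
      = Matrix.vecMul (fun i ↦ k z (x i)) (kernelMatrix k x + noiseMatrix σ x m)⁻¹
        ⬝ᵥ sampleMean x m Y ε ω := by
  rw [skPredictor, Matrix.dotProduct_mulVec]

lemma integrable_sq_skPredictor_sub (hY : IsSecondOrderProcess S k Y P)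
    (hε : IsUncorrelatedNoise S σ x m Y ε P) (hx : ∀ i, x i ∈ S) (hz : z ∈ S) :
    Integrable (fun ω ↦ (skPredictor k σ x m Y ε z ω - Y z ω) ^ 2) P := by
  simp only [skPredictor_eq_dotProduct]
  exact ((memLp_finsetSum _ fun i _ ↦ (memLp_sampleMean hY hε hx i).const_mul _).sub
    (hY.memLp z hz)).integrable_sq

lemma integral_sq_skPredictor_sub_le (hY : IsSecondOrderProcess S k Y P)
    (hε : IsUncorrelatedNoise S σ x m Y ε P) (hx : ∀ i, x i ∈ S) (hm : ∀ i, 1 ≤ m i) (hz : z ∈ S)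
    (hK : (kernelMatrix k x).PosDef) (w : Fin n → ℝ) :
    ∫ ω, (skPredictor k σ x m Y ε z ω - Y z ω) ^ 2 ∂P
      ≤ quadraticRisk (kernelMatrix k x) (fun i ↦ k z (x i)) (k z z) w
        + ∑ i, w i ^ 2 * (σ (x i) ^ 2 / m i) := by
  have hnoise : (noiseMatrix σ x m).PosSemidef := Matrix.PosSemidef.diagonal fun i ↦ by positivity
  simp only [skPredictor_eq_dotProduct]
  rw [integral_sq_dotProduct_sampleMean_sub hY hε hx hm hz, ← quadraticRisk_add_diagonal]
  exact quadraticRisk_vecMul_inv_le (hK.add_posSemidef hnoise)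

lemma integral_sq_skPredictor_sub_le_kernel (hY : IsSecondOrderProcess S k Y P)
    (hε : IsUncorrelatedNoise S σ x m Y ε P) (hx : ∀ i, x i ∈ S) (hm : ∀ i, 1 ≤ m i) (hz : z ∈ S)
    (hK : (kernelMatrix k x).PosDef) :
    ∫ ω, (skPredictor k σ x m Y ε z ω - Y z ω) ^ 2 ∂P ≤ k z z := by
  simpa [quadraticRisk_zero] using integral_sq_skPredictor_sub_le hY hε hx hm hz hK 0

end Kriging

/-! ### The bias of a linear predictor -/

lemma quadraticRisk_kernelMatrix_eq_sum {d n : ℕ} {ι : Type*} {k : (Fin d → ℝ) → (Fin d → ℝ) → ℝ}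
    (hk : ∀ y y', k y y' = k y' y) {x : Fin n → Fin d → ℝ} {z : Fin d → ℝ} {w : Fin n → ℝ}
    {s : Finset ι} {c : ι → ℝ} {y : ι → Fin d → ℝ}
    (hw : ∀ F : (Fin d → ℝ) → ℝ, F z - ∑ i, w i * F (x i) = ∑ a ∈ s, c a * F (y a)) :
    quadraticRisk (kernelMatrix k x) (fun i ↦ k z (x i)) (k z z) w
      = ∑ a ∈ s, c a * ∑ b ∈ s, c b * k (y a) (y b) := by
  rw [← hw fun t ↦ ∑ b ∈ s, c b * k t (y b)]
  simp only [← hw]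
  simp only [quadraticRisk, dotProduct, Matrix.mulVec, kernelMatrix, Matrix.of_apply, mul_sub,
    Finset.sum_sub_distrib, hk _ z, mul_comm (k _ _) (w _)]
  ring

/-! ### Sums over level vectors -/

section LevelSums

variable {e N : ℕ} {B : Finset ℕ} {T : Finset (Fin (e + 1) → ℕ)}

lemma sum_pow_comp_le_of_injOn {ι : Type*} {s : Finset ι} {f : ι → ℕ} (hf : InjOn f s) {r : ℝ}
    (hr₀ : 0 ≤ r) (hr₁ : r < 1) : ∑ i ∈ s, r ^ f i ≤ (1 - r)⁻¹ := by
  classical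
  rw [← Finset.sum_image (f := fun a ↦ r ^ a) hf, ← tsum_geometric_of_lt_one hr₀ hr₁]
  exact (summable_geometric_of_lt_one hr₀ hr₁).sum_le_tsum _ fun _ _ ↦ pow_nonneg hr₀ _

lemma injOn_sum_filter_tail_eq (r : Fin e → ℕ) :
    InjOn (fun l : Fin (e + 1) → ℕ ↦ ∑ j, l j) (T.filter fun l ↦ Fin.tail l = r) := by
  intro l hl l' hl' hsum
  simp only [Finset.coe_filter, Set.mem_ofPred_eq] at hl hl'
  have htail : ∀ j : Fin e, l j.succ = l' j.succ := congrFun (hl.2.trans hl'.2.symm)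
  simp only [Fin.sum_univ_succ, htail, add_left_inj] at hsum
  exact funext (Fin.cases hsum htail)

lemma sum_comp_sum_le (hT : T ⊆ Fintype.piFinset fun _ ↦ B) {g : ℕ → ℝ} (hg : ∀ s, 0 ≤ g s) :
    ∑ l ∈ T, g (∑ j, l j) ≤ (B.card : ℝ) ^ e * ∑ s ∈ T.image (fun l ↦ ∑ j, l j), g s := by
  have htail : ∀ l ∈ T, Fin.tail l ∈ Fintype.piFinset fun _ : Fin e ↦ B := fun l hl ↦
    Fintype.mem_piFinset.2 fun j ↦ Fintype.mem_piFinset.1 (hT hl) j.succ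
  have hcard : (B.card : ℝ) ^ e = (Fintype.piFinset fun _ : Fin e ↦ B).card := by
    simp [Fintype.card_piFinset]
  rw [← Finset.sum_fiberwise_of_maps_to htail, hcard, ← nsmul_eq_mul]
  refine Finset.sum_le_card_nsmul _ _ _ fun r _ ↦ ?_
  rw [← Finset.sum_image (f := g) (injOn_sum_filter_tail_eq r)]
  exact Finset.sum_le_sum_of_subset_of_nonneg
    (Finset.image_subset_image (Finset.filter_subset _ _)) fun s _ _ ↦ hg s

lemma sum_half_pow_le {S : Finset ℕ} (hS : ∀ s ∈ S, N ≤ s) :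
    ∑ s ∈ S, (1 / 2 : ℝ) ^ s ≤ 2 * (1 / 2) ^ N := by
  have hinj : InjOn (fun s ↦ s - N) (S : Set ℕ) := fun a ha b hb hab ↦
    (tsub_left_inj (hS a ha) (hS b hb)).1 hab
  calc ∑ s ∈ S, (1 / 2 : ℝ) ^ s = ∑ s ∈ S, (1 / 2) ^ (s - N) * (1 / 2) ^ N :=
        Finset.sum_congr rfl fun s hs ↦ by rw [← pow_add, Nat.sub_add_cancel (hS s hs)]
    _ = (∑ s ∈ S, (1 / 2) ^ (s - N)) * (1 / 2) ^ N := (Finset.sum_mul ..).symm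
    _ ≤ 2 * (1 / 2) ^ N := by
        gcongr
        exact (sum_pow_comp_le_of_injOn hinj (by norm_num) (by norm_num)).trans_eq (by norm_num)

lemma sum_half_pow_sum_le (hT : T ⊆ Fintype.piFinset fun _ ↦ B) (hN : ∀ l ∈ T, N ≤ ∑ j, l j) :
    ∑ l ∈ T, (1 / 2 : ℝ) ^ (∑ j, l j) ≤ (B.card : ℝ) ^ e * (2 * (1 / 2) ^ N) := by
  refine (sum_comp_sum_le hT (g := fun s ↦ (1 / 2 : ℝ) ^ s) fun s ↦ by positivity).trans ?_
  gcongr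
  exact sum_half_pow_le (Finset.forall_mem_image.2 hN)

lemma sum_two_pow_sum_le (hT : T ⊆ Fintype.piFinset fun _ ↦ B) (hN : ∀ l ∈ T, ∑ j, l j ≤ N) :
    ∑ l ∈ T, (2 : ℝ) ^ (∑ j, l j) ≤ (B.card : ℝ) ^ e * 2 ^ (N + 1) := by
  refine (sum_comp_sum_le hT (g := fun s ↦ (2 : ℝ) ^ s) fun s ↦ by positivity).trans ?_
  have hsub : T.image (fun l ↦ ∑ j, l j) ⊆ Finset.range (N + 1) :=
    Finset.image_subset_iff.2 fun l hl ↦ Finset.mem_range_succ_iff.2 (hN l hl)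
  gcongr
  calc ∑ s ∈ T.image (fun l ↦ ∑ j, l j), (2 : ℝ) ^ s
      ≤ ∑ s ∈ Finset.range (N + 1), (2 : ℝ) ^ s :=
        Finset.sum_le_sum_of_subset_of_nonneg hsub fun _ _ _ ↦ by positivity
    _ ≤ 2 ^ (N + 1) := by
        rw [geom_sum_eq (by norm_num)]
        norm_num

end LevelSums

lemma sum_three_quarters_pow_dist_le (S : Finset ℕ) (a : ℕ) :
    ∑ b ∈ S, (3 / 4 : ℝ) ^ a.dist b ≤ 8 := by
  have hhalf : ∀ p : ℕ → Prop, [DecidablePred p] → InjOn a.dist (S.filter p) →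
      ∑ b ∈ S with p b, (3 / 4 : ℝ) ^ a.dist b ≤ 4 := fun p _ hinj ↦
    (sum_pow_comp_le_of_injOn hinj (by norm_num) (by norm_num)).trans_eq (by norm_num)
  have hle : ∑ b ∈ S with b ≤ a, (3 / 4 : ℝ) ^ a.dist b ≤ 4 := hhalf _ fun b hb c hc h ↦ by
    simp only [Finset.coe_filter, Set.mem_ofPred_eq, Nat.dist] at hb hc h
    omega
  have hgt : ∑ b ∈ S with ¬b ≤ a, (3 / 4 : ℝ) ^ a.dist b ≤ 4 := hhalf _ fun b hb c hc h ↦ by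
    simp only [Finset.coe_filter, Set.mem_ofPred_eq, Nat.dist] at hb hc h
    omega
  rw [← Finset.sum_filter_add_sum_filter_not S (· ≤ a)]
  linarith

lemma sq_min_half_pow_le (a b : ℕ) :
    min ((1 / 2 : ℝ) ^ a) ((1 / 2) ^ b) ^ 2
      ≤ ((1 / 2) ^ a * (3 / 4) ^ a.dist b) * ((1 / 2) ^ b * (3 / 4) ^ a.dist b) := by
  wlog h : a ≤ b generalizing a b
  · rw [min_comm, Nat.dist_comm, mul_comm]
    exact this b a (le_of_not_ge h)
  obtain ⟨c, rfl⟩ := Nat.exists_eq_add_of_le h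
  have hdecay : (1 / 2 : ℝ) ^ c ≤ (3 / 4) ^ c * (3 / 4) ^ c := by
    rw [← mul_pow]
    exact pow_le_pow_left₀ (by norm_num) (by norm_num) c
  rw [min_eq_right (pow_le_pow_of_le_one (by norm_num) (by norm_num) h), Nat.dist_eq_sub_of_le h,
    Nat.add_sub_cancel_left]
  calc ((1 / 2 : ℝ) ^ (a + c)) ^ 2 = (1 / 2) ^ a * (1 / 2) ^ (a + c) * (1 / 2) ^ c := by ring
    _ ≤ (1 / 2) ^ a * (1 / 2) ^ (a + c) * ((3 / 4) ^ c * (3 / 4) ^ c) := by gcongr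
    _ = _ := by ring

section PairSums

variable {ι : Type*} [Fintype ι] {B : Finset ℕ}

lemma prod_min_half_pow_le (l l' : ι → ℕ) :
    ∏ j, min ((1 / 2 : ℝ) ^ l j) ((1 / 2) ^ l' j)
      ≤ (∏ j, (3 / 4 : ℝ) ^ (l j).dist (l' j))
        * (((1 / 2) ^ (∑ j, l j) + (1 / 2) ^ (∑ j, l' j)) / 2) := by
  set D := ∏ j, (3 / 4 : ℝ) ^ (l j).dist (l' j)
  set X := (1 / 2 : ℝ) ^ (∑ j, l j) with hX
  set X' := (1 / 2 : ℝ) ^ (∑ j, l' j) with hX'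
  have hsq : (∏ j, min ((1 / 2 : ℝ) ^ l j) ((1 / 2) ^ l' j)) ^ 2 ≤ (X * D) * (X' * D) := by
    simp only [hX, hX', D, ← Finset.prod_pow_eq_pow_sum, ← Finset.prod_mul_distrib,
      ← Finset.prod_pow]
    exact Finset.prod_le_prod (fun _ _ ↦ by positivity) fun j _ ↦ sq_min_half_pow_le _ _
  refine le_of_sq_le_sq (hsq.trans ?_) (by positivity)
  nlinarith [sq_nonneg (D * (X - X'))]

lemma sum_prod_three_quarters_pow_dist_le [DecidableEq ι] {T : Finset (ι → ℕ)}
    (hT : T ⊆ Fintype.piFinset fun _ ↦ B) (l : ι → ℕ) :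
    ∑ l' ∈ T, ∏ j, (3 / 4 : ℝ) ^ (l j).dist (l' j) ≤ 8 ^ Fintype.card ι := by
  calc ∑ l' ∈ T, ∏ j, (3 / 4 : ℝ) ^ (l j).dist (l' j)
      ≤ ∑ l' ∈ Fintype.piFinset fun _ ↦ B, ∏ j, (3 / 4 : ℝ) ^ (l j).dist (l' j) :=
        Finset.sum_le_sum_of_subset_of_nonneg hT fun _ _ _ ↦ by positivity
    _ = ∏ j, ∑ b ∈ B, (3 / 4 : ℝ) ^ (l j).dist b := by rw [Finset.prod_univ_sum]
    _ ≤ ∏ _j : ι, (8 : ℝ) := by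
        gcongr with j
        exact sum_three_quarters_pow_dist_le B (l j)
    _ = 8 ^ Fintype.card ι := by rw [Finset.prod_const, Finset.card_univ]

lemma sum_sum_prod_min_half_pow_le [DecidableEq ι] {T : Finset (ι → ℕ)}
    (hT : T ⊆ Fintype.piFinset fun _ ↦ B) :
    ∑ l ∈ T, ∑ l' ∈ T, ∏ j, min ((1 / 2 : ℝ) ^ l j) ((1 / 2) ^ l' j)
      ≤ 8 ^ Fintype.card ι * ∑ l ∈ T, (1 / 2 : ℝ) ^ (∑ j, l j) := by
  set D : (ι → ℕ) → (ι → ℕ) → ℝ := fun l l' ↦ ∏ j, (3 / 4 : ℝ) ^ (l j).dist (l' j)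
  set X : (ι → ℕ) → ℝ := fun l ↦ (1 / 2 : ℝ) ^ (∑ j, l j)
  have hD : ∀ l l', D l l' = D l' l := fun l l' ↦
    Finset.prod_congr rfl fun j _ ↦ by rw [Nat.dist_comm]
  have hswap : ∑ l ∈ T, ∑ l' ∈ T, D l l' * X l' = ∑ l ∈ T, ∑ l' ∈ T, D l l' * X l := by
    rw [Finset.sum_comm]
    simp only [hD]
  calc _ ≤ ∑ l ∈ T, ∑ l' ∈ T, D l l' * ((X l + X l') / 2) :=
        Finset.sum_le_sum fun l _ ↦ Finset.sum_le_sum fun l' _ ↦ prod_min_half_pow_le l l'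
    _ = (∑ l ∈ T, ∑ l' ∈ T, D l l' * X l + ∑ l ∈ T, ∑ l' ∈ T, D l l' * X l') / 2 := by
        simp only [mul_div_assoc', mul_add, Finset.sum_add_distrib, Finset.sum_div, add_div]
    _ = ∑ l ∈ T, (∑ l' ∈ T, D l l') * X l := by
        rw [hswap, add_self_div_two]
        simp only [Finset.sum_mul]
    _ ≤ 8 ^ Fintype.card ι * ∑ l ∈ T, X l := by
        rw [Finset.mul_sum]
        gcongr with l
        exact sum_prod_three_quarters_pow_dist_le hT l

end PairSums

/-! ### Lipschitz kernels -/

open scoped NNReal in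
/-- A symmetric kernel which, on `S`, is bounded by `C` and `C`-Lipschitz in each variable. -/
structure IsLipschitzKernelOn {α : Type*} [PseudoMetricSpace α] (C : ℝ≥0) (k : α → α → ℝ)
    (S : Set α) : Prop where
  symm : ∀ s t, k s t = k t s
  abs_le : ∀ s ∈ S, ∀ t ∈ S, |k s t| ≤ C
  lipschitzOnWith : ∀ t ∈ S, LipschitzOnWith C (fun s ↦ k s t) S

section Lipschitz

open scoped NNReal

variable {α : Type*} [PseudoMetricSpace α] {S : Set α} {C : ℝ≥0}

lemma IsLipschitzKernelOn.mono {C' : ℝ≥0} {k : α → α → ℝ} (h : IsLipschitzKernelOn C k S)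
    (hC : C ≤ C') : IsLipschitzKernelOn C' k S where
  symm := h.symm
  abs_le s hs t ht := (h.abs_le s hs t ht).trans hC
  lipschitzOnWith t ht := (h.lipschitzOnWith t ht).weaken hC

lemma exists_abs_le_of_lipschitzOnWith {f : α → ℝ} (hf : LipschitzOnWith C f S)
    (hS : Bornology.IsBounded S) : ∃ M : ℝ≥0, ∀ s ∈ S, |f s| ≤ M := by
  obtain ⟨g, hg, hfg⟩ := hf.extend_real
  obtain ⟨M, hM, hgM⟩ := (hg.isBounded_image hS).exists_pos_norm_le
  exact ⟨⟨M, hM.le⟩, fun s hs ↦ (hfg hs).symm ▸ hgM _ (mem_image_of_mem g hs)⟩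

lemma lipschitzOnWith_mul {f g : α → ℝ} {A B M N : ℝ≥0} (hf : LipschitzOnWith A f S)
    (hg : LipschitzOnWith B g S) (hfM : ∀ s ∈ S, |f s| ≤ M) (hgN : ∀ s ∈ S, |g s| ≤ N) :
    LipschitzOnWith (A * N + M * B) (fun s ↦ f s * g s) S := by
  refine LipschitzOnWith.of_dist_le_mul fun s hs t ht ↦ ?_
  calc dist (f s * g s) (f t * g t) = |(f s - f t) * g s + f t * (g s - g t)| := by
        rw [Real.dist_eq]
        congr 1
        ring
    _ ≤ |f s - f t| * |g s| + |f t| * |g s - g t| := by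
        rw [← abs_mul, ← abs_mul]
        exact abs_add_le _ _
    _ ≤ A * dist s t * N + M * (B * dist s t) := by
        gcongr
        exacts [hf.dist_le_mul s hs t ht, hgN s hs, hfM t ht, hg.dist_le_mul s hs t ht]
    _ = (A * N + M * B : ℝ≥0) * dist s t := by
        push_cast
        ring

end Lipschitz

/-! ### Markov kernels -/

/-- The one-dimensional Markov kernel `p (s ∧ t) * q (s ∨ t)`, a factor of a tensor Markov
kernel. -/
def markovKernel (p q : ℝ → ℝ) (s t : ℝ) : ℝ := p (min s t) * q (max s t)

section MarkovKernel

open scoped NNReal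

variable {d : ℕ}

lemma markovKernel_comm (p q : ℝ → ℝ) (s t : ℝ) :
    markovKernel p q s t = markovKernel p q t s := by
  rw [markovKernel, markovKernel, min_comm, max_comm]

lemma tmKernel_eq_prod (p q : Fin d → ℝ → ℝ) (x y : Fin d → ℝ) :
    tmKernel p q x y = ∏ j, markovKernel (p j) (q j) (x j) (y j) := rfl

lemma tmKernel_comm (p q : Fin d → ℝ → ℝ) (x y : Fin d → ℝ) :
    tmKernel p q x y = tmKernel p q y x := by
  simp only [tmKernel_eq_prod, markovKernel_comm]

lemma exists_isLipschitzKernelOn_markovKernel {p q : ℝ → ℝ} {S : Set ℝ} {A B : ℝ≥0}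
    (hp : LipschitzOnWith A p S) (hq : LipschitzOnWith B q S) (hS : Bornology.IsBounded S) :
    ∃ C : ℝ≥0, IsLipschitzKernelOn C (markovKernel p q) S := by
  obtain ⟨M, hM⟩ := exists_abs_le_of_lipschitzOnWith hp hS
  obtain ⟨N, hN⟩ := exists_abs_le_of_lipschitzOnWith hq hS
  have hmin : ∀ s ∈ S, ∀ t ∈ S, min s t ∈ S := fun s hs t ht ↦ min_rec' S hs ht
  have hmax : ∀ s ∈ S, ∀ t ∈ S, max s t ∈ S := fun s hs t ht ↦ max_rec' S hs ht
  have hbdd : ∀ s ∈ S, ∀ t ∈ S, |markovKernel p q s t| ≤ M * N := fun s hs t ht ↦ by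
    rw [markovKernel, abs_mul]
    exact mul_le_mul (hM _ (hmin s hs t ht)) (hN _ (hmax s hs t ht)) (abs_nonneg _) M.2
  have hlip : ∀ t ∈ S, LipschitzOnWith (A * N + M * B) (fun s ↦ markovKernel p q s t) S := by
    intro t ht
    have hpmin : LipschitzOnWith A (fun s ↦ p (min s t)) S := by
      simpa only [mul_one, Function.comp_def, id] using
        hp.comp (LipschitzWith.id.min_const t).lipschitzOnWith fun s hs ↦ hmin s hs t ht
    have hqmax : LipschitzOnWith B (fun s ↦ q (max s t)) S := by
      simpa only [mul_one, Function.comp_def, id] using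
        hq.comp (LipschitzWith.id.max_const t).lipschitzOnWith fun s hs ↦ hmax s hs t ht
    exact lipschitzOnWith_mul hpmin hqmax (fun s hs ↦ hM _ (hmin s hs t ht))
      fun s hs ↦ hN _ (hmax s hs t ht)
  exact ⟨M * N + (A * N + M * B), markovKernel_comm p q,
    fun s hs t ht ↦ (hbdd s hs t ht).trans (mod_cast le_self_add),
    fun t ht ↦ (hlip t ht).weaken le_add_self⟩

lemma exists_forall_isLipschitzKernelOn_markovKernel {ι : Type*} [Finite ι]
    {p q : ι → ℝ → ℝ} {S : Set ℝ} (hp : ∀ j, ∃ A : ℝ≥0, LipschitzOnWith A (p j) S)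
    (hq : ∀ j, ∃ B : ℝ≥0, LipschitzOnWith B (q j) S) (hS : Bornology.IsBounded S) :
    ∃ C : ℝ≥0, ∀ j, IsLipschitzKernelOn C (markovKernel (p j) (q j)) S := by
  cases nonempty_fintype ι
  choose A hA using hp
  choose B hB using hq
  choose C hC using fun j ↦ exists_isLipschitzKernelOn_markovKernel (hA j) (hB j) hS
  exact ⟨∑ j, C j, fun j ↦
    (hC j).mono (Finset.single_le_sum (fun _ _ ↦ zero_le) (Finset.mem_univ j))⟩

lemma exists_lipschitzOnWith_of_abs_deriv_le {f : ℝ → ℝ} {S : Set ℝ} (hS : Convex ℝ S)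
    (hS' : IsOpen S) (hf : DifferentiableOn ℝ f S) (hb : ∃ B : ℝ, ∀ t ∈ S, |deriv f t| ≤ B) :
    ∃ C : ℝ≥0, LipschitzOnWith C f S := by
  obtain ⟨B, hB⟩ := hb
  exact ⟨B.toNNReal, hS.lipschitzOnWith_of_nnnorm_deriv_le
    (fun t ht ↦ hf.differentiableAt (hS'.mem_nhds ht))
    fun t ht ↦ NNReal.coe_le_coe.1 ((hB t ht).trans (Real.le_coe_toNNReal B))⟩

lemma SturmLiouvilleRegular.exists_lipschitzOnWith {p q : Fin d → ℝ → ℝ}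
    (h : SturmLiouvilleRegular p q) (j : Fin d) :
    (∃ A : ℝ≥0, LipschitzOnWith A (p j) (Ioo 0 1)) ∧
      ∃ B : ℝ≥0, LipschitzOnWith B (q j) (Ioo 0 1) :=
  ⟨exists_lipschitzOnWith_of_abs_deriv_le (convex_Ioo 0 1) isOpen_Ioo
      ((h.p_contDiff j).differentiableOn one_ne_zero) (h.p_deriv_bdd j),
    exists_lipschitzOnWith_of_abs_deriv_le (convex_Ioo 0 1) isOpen_Ioo
      ((h.q_contDiff j).differentiableOn one_ne_zero) (h.q_deriv_bdd j)⟩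

end MarkovKernel

/-! ### Positive definiteness -/

lemma exists_pos_sum_steps {α : Type*} [LinearOrder α] (g : α → ℝ) (S : Finset α)
    (hpos : ∀ t ∈ S, 0 < g t) (hmono : StrictMonoOn g S) :
    ∃ w : α → ℝ, (∀ u ∈ S, 0 < w u) ∧ ∀ t ∈ S, g t = ∑ u ∈ S, if u ≤ t then w u else 0 := by
  induction S using Finset.induction_on_max with
  | empty => exact ⟨fun _ ↦ 0, by simp, by simp⟩
  | insert a S hlt ih =>
    obtain ⟨w, hw, hsum⟩ := ih (fun t ht ↦ hpos t (Finset.mem_insert_of_mem ht))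
      (hmono.mono (by simp))
    have ha : a ∉ S := fun h ↦ lt_irrefl _ (hlt a h)
    have hne : ∀ u ∈ S, u ≠ a := fun u hu ↦ (hlt u hu).ne
    have hjump : ∑ u ∈ S, w u < g a := by
      rcases S.eq_empty_or_nonempty with rfl | hS
      · simpa using hpos a
      · have hmax := S.max'_mem hS
        calc ∑ u ∈ S, w u = g (S.max' hS) := by
              rw [hsum _ hmax]
              exact Finset.sum_congr rfl fun u hu ↦ (if_pos (S.le_max' u hu)).symm
          _ < g a := hmono (by simp [hmax]) (by simp) (hlt _ hmax)
    refine ⟨Function.update w a (g a - ∑ u ∈ S, w u), fun u hu ↦ ?_, fun t ht ↦ ?_⟩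
    · rcases Finset.mem_insert.1 hu with rfl | hu
      · rwa [Function.update_self, sub_pos]
      · rw [Function.update_of_ne (hne u hu)]
        exact hw u hu
    · have hupdate : (∑ u ∈ S, if u ≤ t then Function.update w a (g a - ∑ u ∈ S, w u) u else 0)
          = ∑ u ∈ S, if u ≤ t then w u else 0 :=
        Finset.sum_congr rfl fun u hu ↦ by rw [Function.update_of_ne (hne u hu)]
      rw [Finset.sum_insert ha, Function.update_self, hupdate]
      rcases Finset.mem_insert.1 ht with rfl | ht
      · rw [if_pos le_rfl, Finset.sum_congr rfl fun u hu ↦ if_pos (hlt u hu).le, sub_add_cancel]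
      · rw [if_neg (not_le.2 (hlt t ht)), zero_add]
        exact hsum t ht

lemma exists_markovKernel_eq_sum {p q : ℝ → ℝ} (S : Finset ℝ) (hp : ∀ t ∈ S, 0 < p t)
    (hq : ∀ t ∈ S, 0 < q t) (hmono : StrictMonoOn (fun t ↦ p t / q t) S) :
    ∃ w : ℝ → ℝ, (∀ u ∈ S, 0 < w u) ∧ ∀ s ∈ S, ∀ t ∈ S, markovKernel p q s t
      = ∑ u ∈ S, w u * ((if u ≤ s then q s else 0) * (if u ≤ t then q t else 0)) := by
  obtain ⟨w, hw, hsum⟩ := exists_pos_sum_steps (fun t ↦ p t / q t) S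
    (fun t ht ↦ div_pos (hp t ht) (hq t ht)) hmono
  have hle : ∀ s ∈ S, ∀ t ∈ S, s ≤ t → markovKernel p q s t
      = ∑ u ∈ S, w u * ((if u ≤ s then q s else 0) * (if u ≤ t then q t else 0)) := by
    intro s hs t _ hst
    rw [markovKernel, min_eq_left hst, max_eq_right hst, (div_eq_iff (hq s hs).ne').1 (hsum s hs),
      Finset.sum_mul, Finset.sum_mul]
    refine Finset.sum_congr rfl fun u _ ↦ ?_
    by_cases hu : u ≤ s
    · rw [if_pos hu, if_pos hu, if_pos (hu.trans hst), mul_assoc]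
    · simp [hu]
  refine ⟨w, hw, fun s hs t ht ↦ ?_⟩
  rcases le_total s t with h | h
  · exact hle s hs t ht h
  · rw [markovKernel_comm, hle t ht s hs h]
    exact Finset.sum_congr rfl fun u _ ↦ by rw [mul_comm (ite _ (q t) _)]

lemma posDef_of_eq_sum_mul_triangular {ι U : Type*} [Finite ι] [PartialOrder U]
    {M : Matrix ι ι ℝ} {s : Finset U} {w : U → ℝ} {φ : U → ι → ℝ} {x : ι → U}
    (hM : ∀ i i', M i i' = ∑ u ∈ s, w u * (φ u i * φ u i')) (hw : ∀ u ∈ s, 0 < w u)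
    (hxs : ∀ i, x i ∈ s) (hx : Function.Injective x) (hφ : ∀ u i, ¬ u ≤ x i → φ u i = 0)
    (hφx : ∀ i, φ (x i) i ≠ 0) : M.PosDef := by
  classical
  cases nonempty_fintype ι
  refine Matrix.PosDef.of_dotProduct_mulVec_pos ?_ fun c hc ↦ ?_
  · ext i i'
    simp [hM, mul_comm]
  have hform : star c ⬝ᵥ M.mulVec c = ∑ u ∈ s, w u * (∑ i, c i * φ u i) ^ 2 := by
    simp only [dotProduct, Matrix.mulVec, hM, star_trivial, Finset.mul_sum, Finset.sum_mul, sq]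
    rw [Finset.sum_congr rfl fun i _ ↦ Finset.sum_comm, Finset.sum_comm]
    exact Finset.sum_congr rfl fun u _ ↦ Finset.sum_congr rfl fun i _ ↦
      Finset.sum_congr rfl fun i' _ ↦ by ring
  -- Only one term survives in the factor at `x i` if `x i` is maximal among those with `c i ≠ 0`.
  obtain ⟨i₀, hi₀⟩ := Function.ne_iff.1 hc
  obtain ⟨i, hi⟩ := (Finset.univ.filter fun i ↦ c i ≠ 0).exists_maximalFor x
    ⟨i₀, by simpa using hi₀⟩
  have hci : c i ≠ 0 := (Finset.mem_filter.1 hi.1).2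
  have hterm : ∑ i', c i' * φ (x i) i' = c i * φ (x i) i := by
    refine Finset.sum_eq_single i (fun i' _ hi' ↦ ?_) (by simp)
    by_cases hc' : c i' = 0
    · rw [hc', zero_mul]
    · rw [hφ, mul_zero]
      exact fun hle ↦ hi' (hx (le_antisymm (hi.2 (by simpa using hc') hle) hle))
  rw [hform]
  refine Finset.sum_pos' (fun u hu ↦ mul_nonneg (hw u hu).le (sq_nonneg _)) ⟨x i, hxs i, ?_⟩
  rw [hterm]
  exact mul_pos (hw _ (hxs i)) (sq_pos_of_ne_zero (mul_ne_zero hci (hφx i)))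

lemma IsTensorMarkov.posDef_kernelMatrix {d n : ℕ} {p q : Fin d → ℝ → ℝ}
    (h : IsTensorMarkov p q) {x : Fin n → Fin d → ℝ} (hx : ∀ i, x i ∈ unitCube d)
    (hinj : Function.Injective x) : (kernelMatrix (tmKernel p q) x).PosDef := by
  set S : Fin d → Finset ℝ := fun j ↦ Finset.univ.image fun i ↦ x i j
  have hxS : ∀ i j, x i j ∈ S j := fun i j ↦ Finset.mem_image_of_mem _ (Finset.mem_univ i)
  have hS : ∀ j, ↑(S j) ⊆ Ioo (0 : ℝ) 1 := by
    intro j t ht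
    obtain ⟨i, -, rfl⟩ := Finset.mem_image.1 ht
    exact hx i j
  choose w hw hk using fun j ↦ exists_markovKernel_eq_sum (S j)
    (fun t ht ↦ h.p_pos j t (hS j ht)) (fun t ht ↦ h.q_pos j t (hS j ht))
    ((h.strictMono j).mono (hS j))
  refine posDef_of_eq_sum_mul_triangular (s := Fintype.piFinset S) (w := fun u ↦ ∏ j, w j (u j))
    (φ := fun u i ↦ ∏ j, if u j ≤ x i j then q j (x i j) else 0) (x := x) (fun i i' ↦ ?_)
    (fun u hu ↦ Finset.prod_pos fun j _ ↦ hw j _ (Fintype.mem_piFinset.1 hu j))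
    (fun i ↦ Fintype.mem_piFinset.2 (hxS i)) hinj (fun u i hu ↦ ?_) fun i ↦ ?_
  · rw [kernelMatrix, Matrix.of_apply, tmKernel_eq_prod,
      Finset.prod_congr rfl fun j _ ↦ hk j _ (hxS i j) _ (hxS i' j), Finset.prod_univ_sum]
    simp only [Finset.prod_mul_distrib]
  · obtain ⟨j, hj⟩ := not_forall.1 hu
    exact Finset.prod_eq_zero (Finset.mem_univ j) (if_neg hj)
  · simp only [le_refl, if_true]
    exact Finset.prod_ne_zero_iff.2 fun j _ ↦ (h.q_pos j _ (hx i j)).ne'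

/-! ### The Smolyak combination -/

/-- The coefficient of the `m`-th approximation in the `l`-th hierarchical difference, with the
convention that the `0`-th approximation vanishes. -/
def diffCoeff (l m : ℕ) : ℝ := (if m = l then 1 else 0) - if m + 1 = l then 1 else 0

section Difference

variable {L l l' m : ℕ}

lemma diffCoeff_eq_zero (h : l < m) : diffCoeff l m = 0 := by
  rw [diffCoeff, if_neg (by omega), if_neg (by omega), sub_zero]

lemma sum_diffCoeff (hm : m ∈ Finset.Icc 1 L) :
    ∑ l ∈ Finset.Icc 1 L, diffCoeff l m = if m = L then 1 else 0 := by
  rw [Finset.mem_Icc] at hm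
  simp only [diffCoeff, Finset.sum_sub_distrib, Finset.sum_ite_eq, Finset.mem_Icc]
  split_ifs <;> first | omega | norm_num

lemma sum_diffCoeff_mul (hl : l ∈ Finset.Icc 1 L) (f : ℕ → ℝ) :
    ∑ m ∈ Finset.Icc 1 L, diffCoeff l m * f m = if l = 1 then f 1 else f l - f (l - 1) := by
  obtain ⟨k, rfl⟩ := Nat.exists_eq_add_of_le' (Finset.mem_Icc.1 hl).1
  rw [Finset.mem_Icc] at hl
  simp only [diffCoeff, sub_mul, Finset.sum_sub_distrib, ite_mul, one_mul, zero_mul,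
    Finset.sum_ite_eq', Finset.mem_Icc, Nat.add_right_cancel_iff, Nat.add_sub_cancel]
  rcases Nat.eq_zero_or_pos k with rfl | hk
  · simp [hl.2]
  · rw [if_pos hl, if_pos (by omega), if_neg (by omega)]

lemma sum_abs_diffCoeff_le (L l : ℕ) : ∑ m ∈ Finset.Icc 1 L, |diffCoeff l m| ≤ 2 := by
  have hsub : (Finset.Icc 1 L).filter (diffCoeff l · ≠ 0) ⊆ {l, l - 1} := by
    intro m hm
    have hne := (Finset.mem_filter.1 hm).2
    rw [diffCoeff] at hne
    rw [Finset.mem_insert, Finset.mem_singleton]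
    by_contra!
    rw [if_neg this.1, if_neg (by omega), sub_zero] at hne
    exact hne rfl
  have habs : ∀ m, |diffCoeff l m| ≤ 1 := fun m ↦ by
    rw [diffCoeff]
    split_ifs <;> norm_num
  calc ∑ m ∈ Finset.Icc 1 L, |diffCoeff l m|
      = ∑ m ∈ (Finset.Icc 1 L).filter (diffCoeff l · ≠ 0), |diffCoeff l m| :=
        (Finset.sum_filter_of_ne fun m _ h ↦ abs_ne_zero.1 h).symm
    _ ≤ ((Finset.Icc 1 L).filter (diffCoeff l · ≠ 0)).card • (1 : ℝ) :=
        Finset.sum_le_card_nsmul _ _ _ fun m _ ↦ habs m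
    _ ≤ 2 := by
        rw [nsmul_eq_mul, mul_one]
        exact_mod_cast (Finset.card_le_card hsub).trans Finset.card_le_two

/-- The covariance, for a process with covariance function `k`, of the hierarchical differences of
levels `l` and `l'` of the approximations by the values at the nodes `b 1, …, b L`. -/
def diffCov {α : Type*} (k : α → α → ℝ) (b : ℕ → α) (L l l' : ℕ) : ℝ :=
  ∑ m ∈ Finset.Icc 1 L, ∑ m' ∈ Finset.Icc 1 L,
    diffCoeff l m * diffCoeff l' m' * k (b m) (b m')

lemma diffCov_comm {α : Type*} {k : α → α → ℝ} (hk : ∀ s t, k s t = k t s) (b : ℕ → α)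
    (L l l' : ℕ) : diffCov k b L l l' = diffCov k b L l' l := by
  rw [diffCov, Finset.sum_comm, diffCov]
  refine Finset.sum_congr rfl fun m _ ↦ Finset.sum_congr rfl fun m' _ ↦ ?_
  rw [hk, mul_comm (diffCoeff l m')]

variable {α : Type*} [PseudoMetricSpace α] {S : Set α} {C : NNReal} {k : α → α → ℝ} {b : ℕ → α}
  {t : α}

lemma abs_sum_diffCoeff_mul_kernel_le (hk : IsLipschitzKernelOn C k S)
    (hb : ∀ l ∈ Finset.Icc 1 L, b l ∈ S ∧ dist (b l) t ≤ (1 / 2) ^ l)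
    (hl : l ∈ Finset.Icc 1 L) {s : α} (hs : s ∈ S) :
    |∑ m ∈ Finset.Icc 1 L, diffCoeff l m * k (b m) s| ≤ 3 * C * (1 / 2) ^ l := by
  rw [sum_diffCoeff_mul hl fun m ↦ k (b m) s]
  obtain ⟨hbl, hdist⟩ := hb l hl
  split_ifs with h
  · subst h
    linarith [hk.abs_le _ hbl _ hs, C.2]
  · have hl' : l - 1 ∈ Finset.Icc 1 L := by
      rw [Finset.mem_Icc] at hl ⊢
      omega
    obtain ⟨hbl', hdist'⟩ := hb _ hl'
    have hhalf : (1 / 2 : ℝ) ^ (l - 1) = 2 * (1 / 2) ^ l := by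
      rw [← Nat.sub_add_cancel (Finset.mem_Icc.1 hl).1, pow_succ, Nat.add_sub_cancel]
      ring
    calc |k (b l) s - k (b (l - 1)) s| ≤ C * dist (b l) (b (l - 1)) :=
          (hk.lipschitzOnWith s hs).dist_le_mul _ hbl _ hbl'
      _ ≤ C * (3 * (1 / 2) ^ l) := by
          gcongr
          linarith [dist_triangle_right (b l) (b (l - 1)) t]
      _ = 3 * C * (1 / 2) ^ l := by ring

lemma abs_diffCov_le_left (hk : IsLipschitzKernelOn C k S)
    (hb : ∀ l ∈ Finset.Icc 1 L, b l ∈ S ∧ dist (b l) t ≤ (1 / 2) ^ l)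
    (hl : l ∈ Finset.Icc 1 L) : |diffCov k b L l l'| ≤ 6 * C * (1 / 2) ^ l := by
  have hsplit : diffCov k b L l l' = ∑ m' ∈ Finset.Icc 1 L, diffCoeff l' m' *
      ∑ m ∈ Finset.Icc 1 L, diffCoeff l m * k (b m) (b m') := by
    rw [diffCov, Finset.sum_comm]
    refine Finset.sum_congr rfl fun m' _ ↦ ?_
    rw [Finset.mul_sum]
    exact Finset.sum_congr rfl fun m _ ↦ by ring
  calc |diffCov k b L l l'|
      ≤ ∑ m' ∈ Finset.Icc 1 L, |diffCoeff l' m'| * (3 * C * (1 / 2) ^ l) := by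
        rw [hsplit]
        refine (Finset.abs_sum_le_sum_abs _ _).trans (Finset.sum_le_sum fun m' hm' ↦ ?_)
        rw [abs_mul]
        gcongr
        exact abs_sum_diffCoeff_mul_kernel_le hk hb hl (hb m' hm').1
    _ ≤ 2 * (3 * C * (1 / 2) ^ l) := by
        rw [← Finset.sum_mul]
        gcongr
        exact sum_abs_diffCoeff_le L l'
    _ = 6 * C * (1 / 2) ^ l := by ring

lemma abs_diffCov_le (hk : IsLipschitzKernelOn C k S)
    (hb : ∀ l ∈ Finset.Icc 1 L, b l ∈ S ∧ dist (b l) t ≤ (1 / 2) ^ l)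
    (hl : l ∈ Finset.Icc 1 L) (hl' : l' ∈ Finset.Icc 1 L) :
    |diffCov k b L l l'| ≤ 6 * C * min ((1 / 2) ^ l) ((1 / 2) ^ l') := by
  rw [mul_min_of_nonneg _ _ (by positivity)]
  exact le_min (abs_diffCov_le_left hk hb hl)
    (diffCov_comm hk.symm b L l l' ▸ abs_diffCov_le_left hk hb hl')

end Difference

section Smolyak

variable {ι : Type*} [Fintype ι]

/-- The box of all multi-levels with entries in `{1, …, L}`. -/
abbrev levelBox (ι : Type*) [Fintype ι] [DecidableEq ι] (L : ℕ) : Finset (ι → ℕ) :=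
  Fintype.piFinset fun _ ↦ Finset.Icc 1 L

/-- The coefficient of the approximation of multi-level `m` in the Smolyak combination over `T`,
the sum over the multi-levels in `T` of the tensor products of hierarchical differences. -/
def smolyakCoeff (T : Finset (ι → ℕ)) (m : ι → ℕ) : ℝ :=
  ∑ l ∈ T, ∏ j, diffCoeff (l j) (m j)

lemma exists_le_of_smolyakCoeff_ne_zero {T : Finset (ι → ℕ)} {m : ι → ℕ}
    (h : smolyakCoeff T m ≠ 0) : ∃ l ∈ T, m ≤ l := by
  obtain ⟨l, hl, hprod⟩ := Finset.exists_ne_zero_of_sum_ne_zero h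
  refine ⟨l, hl, fun j ↦ ?_⟩
  by_contra hj
  exact hprod (Finset.prod_eq_zero (Finset.mem_univ j) (diffCoeff_eq_zero (not_le.1 hj)))

variable [DecidableEq ι] {L : ℕ} {T : Finset (ι → ℕ)}

lemma sum_abs_smolyakCoeff_le (T : Finset (ι → ℕ)) (L : ℕ) :
    ∑ m ∈ levelBox ι L, |smolyakCoeff T m| ≤ T.card * 2 ^ Fintype.card ι := by
  calc ∑ m ∈ levelBox ι L, |smolyakCoeff T m|
      ≤ ∑ m ∈ levelBox ι L, ∑ l ∈ T, ∏ j, |diffCoeff (l j) (m j)| := by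
        refine Finset.sum_le_sum fun m _ ↦ (Finset.abs_sum_le_sum_abs _ _).trans_eq ?_
        simp only [Finset.abs_prod]
    _ = ∑ l ∈ T, ∏ j, ∑ m ∈ Finset.Icc 1 L, |diffCoeff (l j) m| := by
        rw [Finset.sum_comm]
        exact Finset.sum_congr rfl fun l _ ↦ by rw [Finset.prod_univ_sum]
    _ ≤ ∑ l ∈ T, 2 ^ Fintype.card ι := by
        refine Finset.sum_le_sum fun l _ ↦ ?_
        exact (Finset.prod_le_prod (fun _ _ ↦ by positivity)
          fun j _ ↦ sum_abs_diffCoeff_le L (l j)).trans_eq (by simp)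
    _ = T.card * 2 ^ Fintype.card ι := by rw [Finset.sum_const, nsmul_eq_mul]

lemma smolyakCoeff_levelBox {m : ι → ℕ} (hm : m ∈ levelBox ι L) :
    smolyakCoeff (levelBox ι L) m = if m = fun _ ↦ L then 1 else 0 := by
  rw [smolyakCoeff, ← Finset.prod_univ_sum (fun _ ↦ Finset.Icc 1 L) fun j l ↦ diffCoeff l (m j),
    Finset.prod_congr rfl fun j _ ↦ sum_diffCoeff (Fintype.mem_piFinset.1 hm j)]
  split_ifs with h
  · simp [h]
  · obtain ⟨j, hj⟩ := Function.ne_iff.1 h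
    exact Finset.prod_eq_zero (Finset.mem_univ j) (if_neg hj)

lemma sub_sum_smolyakCoeff_mul (hT : T ⊆ levelBox ι L) (hL : 1 ≤ L) (F : (ι → ℕ) → ℝ) :
    F (fun _ ↦ L) - ∑ m ∈ levelBox ι L, smolyakCoeff T m * F m
      = ∑ m ∈ levelBox ι L, smolyakCoeff (levelBox ι L \ T) m * F m := by
  have hfull : F (fun _ ↦ L) = ∑ m ∈ levelBox ι L, smolyakCoeff (levelBox ι L) m * F m := by
    rw [Finset.sum_congr rfl fun m hm ↦ by rw [smolyakCoeff_levelBox hm]]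
    simp [hL]
  have hsplit : ∀ m, smolyakCoeff (levelBox ι L) m
      = smolyakCoeff (levelBox ι L \ T) m + smolyakCoeff T m :=
    fun m ↦ (Finset.sum_sdiff hT).symm
  rw [hfull, ← Finset.sum_sub_distrib]
  exact Finset.sum_congr rfl fun m _ ↦ by rw [hsplit, add_mul, add_sub_cancel_right]

lemma sum_smolyakCoeff_mul_sum_kernel {α : Type*} (κ : ι → α → α → ℝ) (b : ι → ℕ → α)
    (T : Finset (ι → ℕ)) (L : ℕ) :
    ∑ m ∈ levelBox ι L, smolyakCoeff T m * ∑ m' ∈ levelBox ι L,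
        smolyakCoeff T m' * ∏ j, κ j (b j (m j)) (b j (m' j))
      = ∑ l ∈ T, ∑ l' ∈ T, ∏ j, diffCov (κ j) (b j) L (l j) (l' j) := by
  have hcov : ∀ l l' : ι → ℕ, ∏ j, diffCov (κ j) (b j) L (l j) (l' j)
      = ∑ m ∈ levelBox ι L, ∑ m' ∈ levelBox ι L, (∏ j, diffCoeff (l j) (m j)) *
          ((∏ j, diffCoeff (l' j) (m' j)) * ∏ j, κ j (b j (m j)) (b j (m' j))) := by
    intro l l'
    simp only [diffCov, Finset.prod_univ_sum, Finset.prod_mul_distrib, mul_assoc]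
  simp only [hcov, smolyakCoeff, Finset.sum_mul, Finset.mul_sum]
  rw [Finset.sum_comm_cycle, Finset.sum_congr rfl fun l' _ ↦ Finset.sum_comm_cycle,
    Finset.sum_comm]

lemma sum_smolyakCoeff_mul_sum_kernel_le {α : Type*} [PseudoMetricSpace α] {S : Set α}
    {C : NNReal} {κ : ι → α → α → ℝ} (hκ : ∀ j, IsLipschitzKernelOn C (κ j) S)
    {b : ι → ℕ → α} {z : ι → α}
    (hb : ∀ j, ∀ l ∈ Finset.Icc 1 L, b j l ∈ S ∧ dist (b j l) (z j) ≤ (1 / 2) ^ l)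
    (hT : T ⊆ levelBox ι L) :
    ∑ m ∈ levelBox ι L, smolyakCoeff T m * ∑ m' ∈ levelBox ι L,
        smolyakCoeff T m' * ∏ j, κ j (b j (m j)) (b j (m' j))
      ≤ (6 * C) ^ Fintype.card ι *
        (8 ^ Fintype.card ι * ∑ l ∈ T, (1 / 2 : ℝ) ^ (∑ j, l j)) := by
  rw [sum_smolyakCoeff_mul_sum_kernel]
  have hprod : ∀ l ∈ T, ∀ l' ∈ T, ∏ j, diffCov (κ j) (b j) L (l j) (l' j)
      ≤ (6 * C) ^ Fintype.card ι * ∏ j, min ((1 / 2 : ℝ) ^ l j) ((1 / 2) ^ l' j) := by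
    intro l hl l' hl'
    calc ∏ j, diffCov (κ j) (b j) L (l j) (l' j)
        ≤ ∏ j, |diffCov (κ j) (b j) L (l j) (l' j)| := by
          rw [← Finset.abs_prod]
          exact le_abs_self _
      _ ≤ ∏ j, 6 * C * min ((1 / 2 : ℝ) ^ l j) ((1 / 2) ^ l' j) :=
          Finset.prod_le_prod (fun _ _ ↦ abs_nonneg _) fun j _ ↦ abs_diffCov_le (hκ j) (hb j)
            (Fintype.mem_piFinset.1 (hT hl) j) (Fintype.mem_piFinset.1 (hT hl') j)
      _ = _ := by rw [Finset.prod_mul_distrib, Finset.prod_const, Finset.card_univ]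
  calc ∑ l ∈ T, ∑ l' ∈ T, ∏ j, diffCov (κ j) (b j) L (l j) (l' j)
      ≤ (6 * C) ^ Fintype.card ι *
          ∑ l ∈ T, ∑ l' ∈ T, ∏ j, min ((1 / 2 : ℝ) ^ l j) ((1 / 2) ^ l' j) := by
        simp only [Finset.mul_sum]
        exact Finset.sum_le_sum fun l hl ↦ Finset.sum_le_sum fun l' hl' ↦ hprod l hl l' hl'
    _ ≤ _ := by
        gcongr
        exact sum_sum_prod_min_half_pow_le hT

end Smolyak

lemma exists_weights_sum_mul_eq {E ι κ : Type*} [Fintype κ] (x : κ → E) (s : Finset ι) (y : ι → E)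
    (c : ι → ℝ) (hy : ∀ m ∈ s, c m ≠ 0 → ∃ i, x i = y m) :
    ∃ w : κ → ℝ, (∀ F : E → ℝ, ∑ i, w i * F (x i) = ∑ m ∈ s, c m * F (y m)) ∧
      ∑ i, |w i| ≤ ∑ m ∈ s, |c m| := by
  classical
  induction s using Finset.induction_on with
  | empty => exact ⟨0, by simp, by simp⟩
  | insert a s ha ih =>
    obtain ⟨w, hw, hmass⟩ := ih fun m hm ↦ hy m (Finset.mem_insert_of_mem hm)
    rcases eq_or_ne (c a) 0 with h0 | h0
    · exact ⟨w, by simpa [ha, h0] using hw, by simpa [ha, h0] using hmass⟩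
    obtain ⟨i₀, hi₀⟩ := hy a (Finset.mem_insert_self a s) h0
    refine ⟨Pi.single i₀ (c a) + w, fun F ↦ ?_, ?_⟩
    · simp [Finset.sum_insert ha, add_mul, Finset.sum_add_distrib, Pi.single_apply, hi₀, hw F]
    · calc ∑ i, |(Pi.single i₀ (c a) + w : κ → ℝ) i|
          ≤ ∑ i, (|(Pi.single i₀ (c a) : κ → ℝ) i| + |w i|) :=
            Finset.sum_le_sum fun i _ ↦ abs_add_le _ _
        _ = |c a| + ∑ i, |w i| := by
            simp [Finset.sum_add_distrib, Pi.single_apply, apply_ite abs]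
        _ ≤ ∑ m ∈ insert a s, |c m| := by
            rw [Finset.sum_insert ha]
            gcongr

/-! ### Sparse grids -/

section DyadicGrid

variable {l : ℕ} {t : ℝ}

lemma mem_Ioo_of_mem_dyadicGrid (ht : t ∈ dyadicGrid l) : t ∈ Ioo (0 : ℝ) 1 := by
  obtain ⟨i, hi, rfl⟩ := Finset.mem_image.1 ht
  have hpos := Nat.two_pow_pos l
  have hi' : 1 ≤ i ∧ i < 2 ^ l := by
    rw [Finset.mem_Icc] at hi
    omega
  refine ⟨div_pos (by exact_mod_cast hi'.1) (by positivity), (div_lt_one (by positivity)).2 ?_⟩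
  exact_mod_cast hi'.2

lemma card_dyadicGrid (l : ℕ) : (dyadicGrid l).card = 2 ^ l - 1 := by
  have hinj : Function.Injective fun i : ℕ ↦ (i : ℝ) / 2 ^ l := fun i i' h ↦
    Nat.cast_injective ((div_left_inj' (by positivity)).1 h)
  rw [dyadicGrid, Finset.card_image_of_injective _ hinj, Nat.card_Icc, Nat.add_sub_cancel]

lemma exists_mem_dyadicGrid_dist_le (hl : 1 ≤ l) (ht : t ∈ Ioo (0 : ℝ) 1) :
    ∃ a ∈ dyadicGrid l, dist a t ≤ (1 / 2) ^ l := by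
  have hpos : (0 : ℝ) < 2 ^ l := by positivity
  have htl : 0 < t * 2 ^ l := mul_pos ht.1 hpos
  have hfloor := Nat.floor_le htl.le
  have hlt_floor := Nat.lt_floor_add_one (t * 2 ^ l)
  have hfloor_lt : ⌊t * 2 ^ l⌋₊ < 2 ^ l := by
    rw [Nat.floor_lt htl.le]
    push_cast
    exact mul_lt_of_lt_one_left hpos ht.2
  have htwo : 2 ≤ 2 ^ l := Nat.le_self_pow (by omega) 2
  set i := max ⌊t * 2 ^ l⌋₊ 1
  have hi : |(i : ℝ) - t * 2 ^ l| ≤ 1 := by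
    rcases Nat.eq_zero_or_pos ⌊t * 2 ^ l⌋₊ with h0 | h0
    · have hi1 : (i : ℝ) = 1 := by simp [i, h0]
      rw [h0, Nat.cast_zero, zero_add] at hlt_floor
      rw [hi1, abs_le]
      constructor <;> linarith
    · have hif : i = ⌊t * 2 ^ l⌋₊ := max_eq_left h0
      rw [hif, abs_le]
      constructor <;> linarith
  refine ⟨(i : ℝ) / 2 ^ l, Finset.mem_image_of_mem _ (Finset.mem_Icc.2 (by omega)), ?_⟩
  calc dist ((i : ℝ) / 2 ^ l) t = |(i : ℝ) - t * 2 ^ l| / 2 ^ l := by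
        rw [Real.dist_eq, ← abs_of_pos hpos, ← abs_div, sub_div, abs_of_pos hpos,
          mul_div_cancel_right₀ _ hpos.ne']
    _ ≤ 1 / 2 ^ l := by gcongr
    _ = (1 / 2) ^ l := (one_div_pow 2 l).symm

end DyadicGrid

section SparseGrid

variable {d n τ : ℕ}

lemma mem_sparseLevels {l : Fin d → ℕ} :
    l ∈ sparseLevels d τ ↔ (∀ j, 1 ≤ l j) ∧ ∑ j, l j ≤ τ + d - 1 := by
  simp only [sparseLevels, Finset.mem_filter, Fintype.mem_piFinset, Finset.mem_Icc]
  refine ⟨fun h ↦ ⟨fun j ↦ (h.1 j).1, h.2⟩, fun h ↦ ⟨fun j ↦ ⟨h.1 j, ?_⟩, h.2⟩⟩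
  exact (Finset.single_le_sum (f := l) (fun _ _ ↦ Nat.zero_le _) (Finset.mem_univ j)).trans h.2

lemma le_of_mem_sparseLevels {l : Fin d → ℕ} (hl : l ∈ sparseLevels d τ) (j : Fin d) :
    l j ≤ τ := by
  obtain ⟨hl1, hsum⟩ := mem_sparseLevels.1 hl
  have hrest : (Finset.univ.erase j).card • 1 ≤ ∑ i ∈ Finset.univ.erase j, l i :=
    Finset.card_nsmul_le_sum _ _ _ fun i _ ↦ hl1 i
  rw [← Finset.add_sum_erase _ _ (Finset.mem_univ j)] at hsum
  rw [Finset.card_erase_of_mem (Finset.mem_univ j), Finset.card_fin, smul_eq_mul] at hrest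
  omega

lemma sparseLevels_subset (d τ : ℕ) :
    sparseLevels d τ ⊆ levelBox (Fin d) (τ + 1) := fun _ hl ↦
  Fintype.mem_piFinset.2 fun j ↦ Finset.mem_Icc.2
    ⟨(mem_sparseLevels.1 hl).1 j, (le_of_mem_sparseLevels hl j).trans (Nat.le_succ τ)⟩

lemma mem_sparseLevels_of_le {l m : Fin d → ℕ} (hl : l ∈ sparseLevels d τ) (hm : ∀ j, 1 ≤ m j)
    (hml : m ≤ l) : m ∈ sparseLevels d τ :=
  mem_sparseLevels.2 ⟨hm, (Finset.sum_le_sum fun j _ ↦ hml j).trans (mem_sparseLevels.1 hl).2⟩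

lemma le_sum_of_mem_levelBox_sdiff_sparseLevels {L : ℕ} {l : Fin d → ℕ}
    (hl : l ∈ levelBox (Fin d) L \ sparseLevels d τ) : τ + d ≤ ∑ j, l j := by
  obtain ⟨hbox, hlevel⟩ := Finset.mem_sdiff.1 hl
  by_contra!
  exact hlevel (mem_sparseLevels.2
    ⟨fun j ↦ (Finset.mem_Icc.1 (Fintype.mem_piFinset.1 hbox j)).1, by omega⟩)

lemma card_sparseLevels_le (d τ : ℕ) : (sparseLevels d τ).card ≤ (τ + d - 1) ^ d :=
  (Finset.card_filter_le _ _).trans_eq (by simp [Fintype.card_piFinset])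

lemma mem_sparseGrid {z : Fin d → ℝ} :
    z ∈ sparseGrid d τ ↔ ∃ l ∈ sparseLevels d τ, ∀ j, z j ∈ dyadicGrid (l j) := by
  simp only [sparseGrid, Finset.mem_biUnion, Fintype.mem_piFinset]

lemma mem_unitCube_of_mem_sparseGrid {z : Fin d → ℝ} (hz : z ∈ sparseGrid d τ) :
    z ∈ unitCube d := by
  obtain ⟨l, -, hl⟩ := mem_sparseGrid.1 hz
  exact fun j ↦ mem_Ioo_of_mem_dyadicGrid (hl j)

lemma card_sparseGrid_le (e τ : ℕ) :
    ((sparseGrid (e + 1) τ).card : ℝ) ≤ ((τ + e : ℕ) : ℝ) ^ e * 2 ^ (τ + e + 1) := by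
  have hcard : (sparseGrid (e + 1) τ).card ≤ ∑ l ∈ sparseLevels (e + 1) τ, 2 ^ (∑ j, l j) := by
    refine Finset.card_biUnion_le.trans (Finset.sum_le_sum fun l _ ↦ ?_)
    rw [Fintype.card_piFinset, ← Finset.prod_pow_eq_pow_sum]
    exact Finset.prod_le_prod' fun j _ ↦ (card_dyadicGrid (l j)).trans_le (Nat.sub_le _ _)
  calc ((sparseGrid (e + 1) τ).card : ℝ)
      ≤ ∑ l ∈ sparseLevels (e + 1) τ, (2 : ℝ) ^ (∑ j, l j) := by exact_mod_cast hcard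
    _ ≤ ((Finset.Icc 1 (τ + e)).card : ℝ) ^ e * 2 ^ (τ + e + 1) :=
        sum_two_pow_sum_le (Finset.filter_subset _ _) fun l hl ↦ (mem_sparseLevels.1 hl).2
    _ = ((τ + e : ℕ) : ℝ) ^ e * 2 ^ (τ + e + 1) := by rw [Nat.card_Icc, Nat.add_sub_cancel]

lemma two_pow_le_card_sparseGrid (e : ℕ) (hτ : 1 ≤ τ) :
    2 ^ τ - 1 ≤ (sparseGrid (e + 1) τ).card := by
  have hhalf : (1 / 2 : ℝ) ∈ dyadicGrid 1 := by simp [dyadicGrid]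
  have hlevel : Fin.cons τ (fun _ ↦ 1) ∈ sparseLevels (e + 1) τ :=
    mem_sparseLevels.2 ⟨Fin.cases hτ fun _ ↦ le_rfl, by simp [Fin.sum_univ_succ]⟩
  have hproj : dyadicGrid τ ⊆ (sparseGrid (e + 1) τ).image fun z ↦ z 0 := fun t ht ↦
    Finset.mem_image.2 ⟨Fin.cons t fun _ ↦ 1 / 2,
      mem_sparseGrid.2 ⟨_, hlevel, Fin.cases ht fun _ ↦ hhalf⟩, rfl⟩
  rw [← card_dyadicGrid]
  exact (Finset.card_le_card hproj).trans Finset.card_image_le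

lemma IsTruncatedSparseGrid.card_eq {X : Finset (Fin d → ℝ)} (h : IsTruncatedSparseGrid d n X) :
    X.card = n := by
  obtain ⟨τ, -, hτn, -, A, hA, hAcard, rfl⟩ := h
  rw [Finset.card_union_of_disjoint (Finset.disjoint_of_subset_right hA Finset.disjoint_sdiff),
    hAcard, Nat.add_sub_cancel' hτn]

lemma IsTruncatedSparseGrid.apply_mem_unitCube {x : Fin n → Fin d → ℝ}
    (h : IsTruncatedSparseGrid d n (Finset.univ.image x)) (i : Fin n) : x i ∈ unitCube d := by
  obtain ⟨τ, -, -, -, A, hA, -, hX⟩ := h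
  have hi : x i ∈ sparseGrid d τ ∪ A := hX ▸ Finset.mem_image_of_mem x (Finset.mem_univ i)
  rcases Finset.mem_union.1 hi with hi | hi
  · exact mem_unitCube_of_mem_sparseGrid hi
  · exact mem_unitCube_of_mem_sparseGrid (Finset.mem_sdiff.1 (hA hi)).1

lemma IsTruncatedSparseGrid.injective {x : Fin n → Fin d → ℝ}
    (h : IsTruncatedSparseGrid d n (Finset.univ.image x)) : Function.Injective x := by
  have hinj : Set.InjOn x (Finset.univ : Finset (Fin n)) :=
    Finset.card_image_iff.1 (by simpa using h.card_eq)
  rwa [Finset.coe_univ, Set.injOn_univ] at hinj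

lemma exists_dyadicGrid_approximation (τ : ℕ) {z : Fin d → ℝ} (hz : z ∈ unitCube d) :
    ∃ b : Fin d → ℕ → ℝ, (∀ j, b j (τ + 1) = z j) ∧
      (∀ j, ∀ l ∈ Finset.Icc 1 τ, b j l ∈ dyadicGrid l) ∧
      ∀ j, ∀ l ∈ Finset.Icc 1 (τ + 1), b j l ∈ Ioo (0 : ℝ) 1 ∧
        dist (b j l) (z j) ≤ (1 / 2) ^ l := by
  choose! a ha hdist using fun j l (hl : 1 ≤ l) ↦ exists_mem_dyadicGrid_dist_le hl (hz j)
  refine ⟨fun j l ↦ if l = τ + 1 then z j else a j l, fun j ↦ if_pos rfl, fun j l hl ↦ ?_,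
    fun j l hl ↦ ?_⟩ <;> rw [Finset.mem_Icc] at hl <;> dsimp only
  · rw [if_neg (by omega)]
    exact ha j l hl.1
  · split_ifs
    · exact ⟨hz j, by simp⟩
    · exact ⟨mem_Ioo_of_mem_dyadicGrid (ha j l hl.1), hdist j l hl.1⟩

end SparseGrid

/-! ### Smolyak weights on a sparse grid -/

section SmolyakWeights

variable {τ : ℕ}

lemma mem_sparseGrid_of_smolyakCoeff_ne_zero {d : ℕ} {b : Fin d → ℕ → ℝ} {m : Fin d → ℕ}
    (hb : ∀ j, ∀ l ∈ Finset.Icc 1 τ, b j l ∈ dyadicGrid l) (hm : ∀ j, 1 ≤ m j)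
    (h : smolyakCoeff (sparseLevels d τ) m ≠ 0) : (fun j ↦ b j (m j)) ∈ sparseGrid d τ := by
  obtain ⟨l, hl, hml⟩ := exists_le_of_smolyakCoeff_ne_zero h
  have hmT := mem_sparseLevels_of_le hl hm hml
  exact mem_sparseGrid.2
    ⟨m, hmT, fun j ↦ hb j _ (Finset.mem_Icc.2 ⟨hm j, le_of_mem_sparseLevels hmT j⟩)⟩

lemma sum_half_pow_sum_sdiff_sparseLevels_le (e τ : ℕ) :
    ∑ l ∈ levelBox (Fin (e + 1)) (τ + 1) \ sparseLevels (e + 1) τ, (1 / 2 : ℝ) ^ (∑ j, l j)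
      ≤ (τ + 1) ^ e * (2 * (1 / 2) ^ (τ + (e + 1))) := by
  refine (sum_half_pow_sum_le Finset.sdiff_subset
    fun l hl ↦ le_sum_of_mem_levelBox_sdiff_sparseLevels hl).trans_eq ?_
  rw [Nat.card_Icc, Nat.add_sub_cancel, Nat.cast_add_one]

lemma exists_weights_quadraticRisk_le {e n : ℕ} {p q : Fin (e + 1) → ℝ → ℝ} {C : NNReal}
    (hk : ∀ j, IsLipschitzKernelOn C (markovKernel (p j) (q j)) (Ioo 0 1))
    {x : Fin n → Fin (e + 1) → ℝ} (hx : ∀ y ∈ sparseGrid (e + 1) τ, ∃ i, x i = y)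
    {z : Fin (e + 1) → ℝ} (hz : z ∈ unitCube (e + 1)) :
    ∃ w : Fin n → ℝ, ∑ i, |w i| ≤ ((τ + e) ^ (e + 1) * 2 ^ (e + 1) : ℝ) ∧
      quadraticRisk (kernelMatrix (tmKernel p q) x) (fun i ↦ tmKernel p q z (x i))
          (tmKernel p q z z) w
        ≤ (6 * C) ^ (e + 1) *
          (8 ^ (e + 1) * ((τ + 1) ^ e * (2 * (1 / 2) ^ (τ + (e + 1))))) := by
  obtain ⟨b, hbz, hbgrid, hb⟩ := exists_dyadicGrid_approximation τ hz
  set T := sparseLevels (e + 1) τ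
  set B := levelBox (Fin (e + 1)) (τ + 1)
  have hdesign : ∀ m ∈ B, smolyakCoeff T m ≠ 0 → ∃ i, x i = fun j ↦ b j (m j) := fun m hm hne ↦
    hx _ (mem_sparseGrid_of_smolyakCoeff_ne_zero hbgrid
      (fun j ↦ (Finset.mem_Icc.1 (Fintype.mem_piFinset.1 hm j)).1) hne)
  obtain ⟨w, hw, hmass⟩ := exists_weights_sum_mul_eq x B _ (smolyakCoeff T) hdesign
  have herr : ∀ F : (Fin (e + 1) → ℝ) → ℝ, F z - ∑ i, w i * F (x i)
      = ∑ m ∈ B, smolyakCoeff (B \ T) m * F fun j ↦ b j (m j) := fun F ↦ by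
    rw [hw, ← sub_sum_smolyakCoeff_mul (sparseLevels_subset _ τ) (Nat.le_add_left 1 τ), funext hbz]
  refine ⟨w, (hmass.trans (sum_abs_smolyakCoeff_le T (τ + 1))).trans ?_, ?_⟩
  · rw [Fintype.card_fin]
    gcongr
    exact_mod_cast card_sparseLevels_le (e + 1) τ
  · rw [quadraticRisk_kernelMatrix_eq_sum (tmKernel_comm p q) herr]
    simp only [tmKernel_eq_prod]
    refine (sum_smolyakCoeff_mul_sum_kernel_le hk hb Finset.sdiff_subset).trans ?_
    rw [Fintype.card_fin]
    gcongr
    exact sum_half_pow_sum_sdiff_sparseLevels_le e τ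

lemma tmKernel_self_le {d : ℕ} {p q : Fin d → ℝ → ℝ} {C : NNReal}
    (hk : ∀ j, IsLipschitzKernelOn C (markovKernel (p j) (q j)) (Ioo 0 1)) {z : Fin d → ℝ}
    (hz : z ∈ unitCube d) : tmKernel p q z z ≤ C ^ d := by
  calc tmKernel p q z z ≤ |∏ j, markovKernel (p j) (q j) (z j) (z j)| := by
        rw [tmKernel_eq_prod]
        exact le_abs_self _
    _ ≤ ∏ _j : Fin d, (C : ℝ) := by
        rw [Finset.abs_prod]
        exact Finset.prod_le_prod (fun _ _ ↦ abs_nonneg _)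
          fun j _ ↦ (hk j).abs_le _ (hz j) _ (hz j)
    _ = C ^ d := by rw [Finset.prod_const, Finset.card_fin]

end SmolyakWeights

section Noise

variable {d n : ℕ} {σ : (Fin d → ℝ) → ℝ} {x : Fin n → Fin d → ℝ} {m : Fin n → ℕ}

lemma maxNoise_nonneg (hσ : ∀ i, 0 ≤ σ (x i)) : 0 ≤ maxNoise σ x m :=
  Real.iSup_nonneg fun i ↦ mul_nonneg (by positivity) (hσ i)

lemma sq_div_le_sq_maxNoise (hσ : ∀ i, 0 ≤ σ (x i)) (i : Fin n) :
    σ (x i) ^ 2 / m i ≤ maxNoise σ x m ^ 2 := by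
  have hpow : ((m i : ℝ) ^ (-(1 / 2) : ℝ)) ^ 2 = (m i : ℝ)⁻¹ := by
    rw [← Real.rpow_mul_natCast (Nat.cast_nonneg _), ← Real.rpow_neg_one]
    norm_num
  calc σ (x i) ^ 2 / m i = ((m i : ℝ) ^ (-(1 / 2) : ℝ) * σ (x i)) ^ 2 := by
        rw [mul_pow, hpow, inv_mul_eq_div]
    _ ≤ maxNoise σ x m ^ 2 := pow_le_pow_left₀ (mul_nonneg (by positivity) (hσ i))
        (le_ciSup (Set.finite_range fun i ↦ (m i : ℝ) ^ (-(1 / 2) : ℝ) * σ (x i)).bddAbove i) 2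

lemma sum_sq_mul_noise_le (hσ : ∀ i, 0 ≤ σ (x i)) (w : Fin n → ℝ) :
    ∑ i, w i ^ 2 * (σ (x i) ^ 2 / m i) ≤ ((∑ i, |w i|) * maxNoise σ x m) ^ 2 := by
  calc ∑ i, w i ^ 2 * (σ (x i) ^ 2 / m i) ≤ ∑ i, |w i| ^ 2 * maxNoise σ x m ^ 2 := by
        simp only [sq_abs]
        gcongr with i
        exact sq_div_le_sq_maxNoise hσ i
    _ ≤ ((∑ i, |w i|) * maxNoise σ x m) ^ 2 := by
        rw [← Finset.sum_mul, mul_pow]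
        gcongr
        exact Finset.sum_sq_le_sq_sum_of_nonneg fun i _ ↦ abs_nonneg _

end Noise

/-! ### Rates -/

section Rates

variable {e n τ : ℕ}

lemma level_le_log (hn : 2 ≤ n) (h : 2 ^ τ - 1 ≤ n) : (τ : ℝ) ≤ 4 * Real.log n := by
  have hpow : (2 : ℝ) ^ τ ≤ (n : ℝ) ^ 2 := by
    have : 2 ^ τ ≤ n ^ 2 := by nlinarith [Nat.sub_le_iff_le_add.1 h]
    exact_mod_cast this
  have hlog := Real.log_le_log (by positivity) hpow
  rw [Real.log_pow, Real.log_pow, Nat.cast_ofNat] at hlog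
  nlinarith [Real.log_two_gt_d9, Nat.cast_nonneg (α := ℝ) τ]

lemma level_add_le_log (hn : 2 ≤ n) (hτ : 1 ≤ τ) (h : (sparseGrid (e + 1) τ).card ≤ n) :
    (τ + e + 1 : ℝ) ≤ 4 * (e + 2) * Real.log n := by
  have hτ' : (1 : ℝ) ≤ τ := by exact_mod_cast hτ
  calc (τ + e + 1 : ℝ) ≤ (e + 2) * τ := by nlinarith [Nat.cast_nonneg (α := ℝ) e]
    _ ≤ (e + 2) * (4 * Real.log n) := by
        gcongr
        exact level_le_log hn ((two_pow_le_card_sparseGrid e hτ).trans h)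
    _ = 4 * (e + 2) * Real.log n := by ring

lemma half_pow_level_le (hn : 1 ≤ n) (h : n < (sparseGrid (e + 1) (τ + 1)).card) :
    (1 / 2 : ℝ) ^ (τ + (e + 1)) ≤ (n : ℝ)⁻¹ * (2 * (τ + e + 1) ^ e) := by
  have hn' : (0 : ℝ) < n := by exact_mod_cast hn
  have hcard : (n : ℝ) ≤ 2 * (τ + e + 1) ^ e * 2 ^ (τ + (e + 1)) := by
    calc (n : ℝ) ≤ ((τ + 1 + e : ℕ) : ℝ) ^ e * 2 ^ (τ + 1 + e + 1) :=
          (Nat.cast_le.2 h.le).trans (card_sparseGrid_le e (τ + 1))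
      _ = 2 * (τ + e + 1) ^ e * 2 ^ (τ + (e + 1)) := by
          push_cast
          ring
  rwa [inv_mul_eq_div, one_div_pow, div_le_div_iff₀ (by positivity) hn', one_mul]

lemma bias_le_log (hn : 2 ≤ n) (hτ : 1 ≤ τ) (hle : (sparseGrid (e + 1) τ).card ≤ n)
    (hlt : n < (sparseGrid (e + 1) (τ + 1)).card) :
    ((τ + 1) ^ e * (2 * (1 / 2) ^ (τ + (e + 1))) : ℝ)
      ≤ 4 * (4 * (e + 2)) ^ (2 * e) * ((n : ℝ)⁻¹ * Real.log n ^ (2 * e)) := by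
  calc ((τ + 1) ^ e * (2 * (1 / 2) ^ (τ + (e + 1))) : ℝ)
      ≤ (τ + e + 1) ^ e * (2 * ((n : ℝ)⁻¹ * (2 * (τ + e + 1) ^ e))) := by
        gcongr
        · linarith [Nat.cast_nonneg (α := ℝ) e]
        · exact half_pow_level_le (by omega) hlt
    _ = 4 * ((n : ℝ)⁻¹ * (τ + e + 1) ^ (2 * e)) := by ring
    _ ≤ 4 * ((n : ℝ)⁻¹ * (4 * (e + 2) * Real.log n) ^ (2 * e)) := by
        gcongr
        exact level_add_le_log hn hτ hle
    _ = 4 * (4 * (e + 2)) ^ (2 * e) * ((n : ℝ)⁻¹ * Real.log n ^ (2 * e)) := by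
        rw [mul_pow _ (Real.log n)]
        ring

lemma mass_le_log (hn : 2 ≤ n) (hτ : 1 ≤ τ) (hle : (sparseGrid (e + 1) τ).card ≤ n) :
    ((τ + e) ^ (e + 1) * 2 ^ (e + 1) : ℝ) ≤ (8 * (e + 2)) ^ (e + 1) * Real.log n ^ (e + 1) := by
  rw [← mul_pow, ← mul_pow]
  exact pow_le_pow_left₀ (by positivity) (by linarith [level_add_le_log hn hτ hle]) _

lemma IsTruncatedSparseGrid.exists_weights_quadraticRisk_le_log {x : Fin n → Fin (e + 1) → ℝ}
    (hx : IsTruncatedSparseGrid (e + 1) n (Finset.univ.image x)) (hn : 2 ≤ n)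
    {p q : Fin (e + 1) → ℝ → ℝ} {C : NNReal}
    (hk : ∀ j, IsLipschitzKernelOn C (markovKernel (p j) (q j)) (Ioo 0 1))
    {z : Fin (e + 1) → ℝ} (hz : z ∈ unitCube (e + 1)) :
    ∃ w : Fin n → ℝ, ∑ i, |w i| ≤ (8 * (e + 2)) ^ (e + 1) * Real.log n ^ (e + 1) ∧
      quadraticRisk (kernelMatrix (tmKernel p q) x) (fun i ↦ tmKernel p q z (x i))
          (tmKernel p q z z) w
        ≤ (6 * C) ^ (e + 1) * (8 ^ (e + 1) *
          (4 * (4 * (e + 2)) ^ (2 * e) * ((n : ℝ)⁻¹ * Real.log n ^ (2 * e)))) := by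
  obtain ⟨τ, hτ, hle, hlt, A, -, -, hX⟩ := hx
  have hgrid : ∀ y ∈ sparseGrid (e + 1) τ, ∃ i, x i = y := fun y hy ↦ by
    have hy' : y ∈ Finset.univ.image x := hX ▸ Finset.mem_union_left A hy
    simpa using hy'
  obtain ⟨w, hmass, hrisk⟩ := exists_weights_quadraticRisk_le hk hgrid hz
  refine ⟨w, hmass.trans (mass_le_log hn hτ hle), hrisk.trans ?_⟩
  gcongr (6 * C) ^ (e + 1) * (8 ^ (e + 1) * ?_)
  exact bias_le_log hn hτ hle hlt

lemma exists_integral_sq_skPredictor_sub_le {Ω : Type*} [MeasurableSpace Ω] {P : Measure Ω} {d : ℕ}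
    (hd : 1 ≤ d) {p q : Fin d → ℝ → ℝ} (hTM : IsTensorMarkov p q) {C : NNReal}
    (hk : ∀ j, IsLipschitzKernelOn C (markovKernel (p j) (q j)) (Ioo 0 1))
    {Y : (Fin d → ℝ) → Ω → ℝ} (hY : IsSecondOrderProcess (unitCube d) (tmKernel p q) Y P)
    {σ : (Fin d → ℝ) → ℝ} (hσ : ∀ z ∈ unitCube d, 0 ≤ σ z) :
    ∃ K : ℝ, 0 ≤ K ∧ ∀ n ≥ 2, ∀ x : Fin n → Fin d → ℝ, ∀ m : Fin n → ℕ, ∀ ε : Fin n → ℕ → Ω → ℝ,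
      IsTruncatedSparseGrid d n (Finset.univ.image x) → (∀ i, 1 ≤ m i) →
      IsUncorrelatedNoise (unitCube d) σ x m Y ε P → ∀ z ∈ unitCube d,
      ∫ ω, (skPredictor (tmKernel p q) σ x m Y ε z ω - Y z ω) ^ 2 ∂P
        ≤ K * ((n : ℝ)⁻¹ * Real.log n ^ (2 * (d - 1)) + (Real.log n ^ d * maxNoise σ x m) ^ 2) := by
  obtain ⟨e, rfl⟩ := Nat.exists_eq_add_of_le' hd
  set K₁ : ℝ := (6 * C) ^ (e + 1) * (8 ^ (e + 1) * (4 * (4 * (e + 2)) ^ (2 * e))) with hK₁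
  set K₂ : ℝ := (8 * (e + 2)) ^ (e + 1)
  refine ⟨K₁ + K₂ ^ 2, by positivity, fun n hn x m ε hx hm hε z hz ↦ ?_⟩
  have hcube := hx.apply_mem_unitCube
  have hσx : ∀ i, 0 ≤ σ (x i) := fun i ↦ hσ _ (hcube i)
  have hmax := maxNoise_nonneg (m := m) hσx
  have hK := hTM.posDef_kernelMatrix hcube hx.injective
  obtain ⟨w, hmass, hrisk⟩ := hx.exists_weights_quadraticRisk_le_log hn hk hz
  rw [Nat.add_sub_cancel]
  set r : ℝ := (n : ℝ)⁻¹ * Real.log n ^ (2 * e)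
  set s : ℝ := Real.log n ^ (e + 1) * maxNoise σ x m with hs
  have hnoise : ∑ i, w i ^ 2 * (σ (x i) ^ 2 / m i) ≤ (K₂ * s) ^ 2 := by
    refine (sum_sq_mul_noise_le hσx w).trans ?_
    rw [hs, ← mul_assoc]
    gcongr
  calc ∫ ω, (skPredictor (tmKernel p q) σ x m Y ε z ω - Y z ω) ^ 2 ∂P
      ≤ (6 * C) ^ (e + 1) * (8 ^ (e + 1) * (4 * (4 * (e + 2)) ^ (2 * e) * r)) + (K₂ * s) ^ 2 :=
        (integral_sq_skPredictor_sub_le hY hε hcube hm hz hK w).trans (add_le_add hrisk hnoise)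
    _ = K₁ * r + K₂ ^ 2 * s ^ 2 := by
        rw [hK₁]
        ring
    _ ≤ (K₁ + K₂ ^ 2) * (r + s ^ 2) := by
        have hrest : 0 ≤ K₁ * s ^ 2 + K₂ ^ 2 * r := by positivity
        linarith

lemma isBigO_add_sq_of_tendsto_zero {α : Type*} {l : Filter α} {f g : α → ℝ} (hf : 0 ≤ f)
    (hg : 0 ≤ g) (hlim : Tendsto g l (𝓝 0)) :
    (fun a ↦ f a + g a ^ 2) =O[l] fun a ↦ f a + g a := by
  refine IsBigO.of_bound' ?_
  filter_upwards [hlim.eventually_le_const one_pos] with a ha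
  rw [Real.norm_of_nonneg (add_nonneg (hf a) (sq_nonneg _)),
    Real.norm_of_nonneg (add_nonneg (hf a) (hg a))]
  gcongr
  exact pow_le_of_le_one (hg a) ha two_ne_zero

end Rates

end SparseKriging

open SparseKriging in
theorem theorem3_general {Ω : Type*} [MeasurableSpace Ω] (P : Measure Ω) (d : ℕ) (hd : 1 ≤ d)
    (p q : Fin d → ℝ → ℝ) (hTM : IsTensorMarkov p q)
    (hp : ∀ j, ∃ A, LipschitzOnWith A (p j) (Ioo 0 1))
    (hq : ∀ j, ∃ B, LipschitzOnWith B (q j) (Ioo 0 1))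
    (Y : (Fin d → ℝ) → Ω → ℝ)
    (hY : IsSecondOrderProcess (unitCube d) (tmKernel p q) Y P)
    (σ : (Fin d → ℝ) → ℝ) (hσ : ∀ z ∈ unitCube d, 0 ≤ σ z)
    (x : (n : ℕ) → Fin n → Fin d → ℝ)
    (hx : ∀ n, 1 ≤ n → IsTruncatedSparseGrid d n (Finset.univ.image (x n)))
    (m : (n : ℕ) → Fin n → ℕ) (hm : ∀ n i, 1 ≤ m n i)
    (ε : (n : ℕ) → Fin n → ℕ → Ω → ℝ)
    (hε : ∀ n, IsUncorrelatedNoise (unitCube d) σ (x n) (m n) Y (ε n) P) :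
    (∀ n, ∀ z ∈ unitCube d,
      Integrable (fun ω ↦ (skPredictor (tmKernel p q) σ (x n) (m n) Y (ε n) z ω - Y z ω) ^ 2)
        P) ∧
    (∀ n, BddAbove (Set.range fun z : unitCube d ↦
      ∫ ω, (skPredictor (tmKernel p q) σ (x n) (m n) Y (ε n) z ω - Y z ω) ^ 2 ∂P)) ∧
    (fun n : ℕ ↦ ⨆ z : unitCube d,
      ∫ ω, (skPredictor (tmKernel p q) σ (x n) (m n) Y (ε n) z ω - Y z ω) ^ 2 ∂P)
      =O[atTop] (fun n : ℕ ↦ (n : ℝ)⁻¹ * Real.log n ^ (2 * (d - 1))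
        + (Real.log n ^ d * maxNoise σ (x n) (m n)) ^ 2) := by
  have hcube : ∀ n i, x n i ∈ unitCube d := fun n i ↦ (hx n i.pos).apply_mem_unitCube i
  have hinj : ∀ n, Function.Injective (x n) := fun n i ↦ (hx n i.pos).injective (a₁ := i)
  obtain ⟨C, hk⟩ := exists_forall_isLipschitzKernelOn_markovKernel hp hq
    (Metric.isBounded_Ioo (0 : ℝ) 1)
  obtain ⟨K, hK, hrate⟩ := exists_integral_sq_skPredictor_sub_le hd hTM hk hY hσ
  refine ⟨fun n z hz ↦ integrable_sq_skPredictor_sub hY (hε n) (hcube n) hz,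
    fun n ↦ ⟨C ^ d, ?_⟩, IsBigO.of_bound K ?_⟩
  · rintro _ ⟨z, rfl⟩
    exact (integral_sq_skPredictor_sub_le_kernel hY (hε n) (hcube n) (hm n) z.2
      (hTM.posDef_kernelMatrix (hcube n) (hinj n))).trans (tmKernel_self_le hk z.2)
  · filter_upwards [eventually_ge_atTop 2] with n hn
    rw [Real.norm_of_nonneg (Real.iSup_nonneg fun z ↦ integral_nonneg fun ω ↦ sq_nonneg _),
      Real.norm_of_nonneg (by positivity)]
    exact Real.iSup_le (fun z ↦ hrate n hn _ _ _ (hx n (by omega)) (hm n) (hε n) z z.2)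
      (by positivity)

theorem theorem3 {Ω : Type*} [MeasurableSpace Ω] (P : Measure Ω) [IsProbabilityMeasure P]
    (d : ℕ) (hd : 1 ≤ d)
    (p q : Fin d → ℝ → ℝ) (hTM : SparseKriging.IsTensorMarkov p q)
    (hSL : SparseKriging.SturmLiouvilleRegular p q)
    (Y : (Fin d → ℝ) → Ω → ℝ)
    (hY : SparseKriging.IsCenteredGP (SparseKriging.unitCube d)
      (SparseKriging.tmKernel p q) Y P)
    (σ : (Fin d → ℝ) → ℝ) (hσ : ∀ z ∈ SparseKriging.unitCube d, 0 ≤ σ z)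
    (x : (n : ℕ) → Fin n → Fin d → ℝ)
    (hx : ∀ n, 1 ≤ n → SparseKriging.IsTruncatedSparseGrid d n (Finset.univ.image (x n)))
    (m : (n : ℕ) → Fin n → ℕ) (hm : ∀ n i, 1 ≤ m n i)
    (ε : (n : ℕ) → Fin n → ℕ → Ω → ℝ)
    (hε : ∀ n, SparseKriging.IsSimulationNoise σ (x n) (m n) Y (ε n) P)
    (hlim : Tendsto (fun n : ℕ => Real.log n ^ d * SparseKriging.maxNoise σ (x n) (m n))
      atTop (𝓝 0)) :
    (∀ n, ∀ z ∈ SparseKriging.unitCube d,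
      Integrable (fun ω => (SparseKriging.skPredictor (SparseKriging.tmKernel p q) σ (x n) (m n)
        Y (ε n) z ω - Y z ω) ^ 2) P) ∧
    (∀ n, BddAbove (Set.range fun z : SparseKriging.unitCube d =>
      ∫ ω, (SparseKriging.skPredictor (SparseKriging.tmKernel p q) σ (x n) (m n)
        Y (ε n) z ω - Y z ω) ^ 2 ∂P)) ∧
    (fun n : ℕ => ⨆ z : SparseKriging.unitCube d,
      ∫ ω, (SparseKriging.skPredictor (SparseKriging.tmKernel p q) σ (x n) (m n)
        Y (ε n) z ω - Y z ω) ^ 2 ∂P)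
      =O[atTop] (fun n : ℕ => (n : ℝ)⁻¹ * Real.log n ^ (2 * (d - 1))
        + Real.log n ^ d * SparseKriging.maxNoise σ (x n) (m n)) := by
  have h := theorem3_general P d hd p q hTM (fun j ↦ (hSL.exists_lipschitzOnWith j).1)
    (fun j ↦ (hSL.exists_lipschitzOnWith j).2) Y hY.isSecondOrderProcess σ hσ x hx m hm ε
    fun n ↦ (hε n).isUncorrelatedNoise
      fun z hz ↦ (hY.isSecondOrderProcess.memLp z hz).aestronglyMeasurable
  refine ⟨h.1, h.2.1, h.2.2.trans (SparseKriging.isBigO_add_sq_of_tendsto_zero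
    (fun n ↦ by positivity) (fun n ↦ ?_) hlim)⟩
  exact mul_nonneg (pow_nonneg (Real.log_natCast_nonneg n) d)
    (SparseKriging.maxNoise_nonneg fun i ↦ hσ _ ((hx n i.pos).apply_mem_unitCube i))
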